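/- **Model.** Base stations other than the serving one form a homogeneous Poisson point process $\Phi=\{x_i\}$ of intensity $\lambda>0$ in the plane; the user is at the origin, and the serving station $\mathrm{SBS}^r$ is at distance $r$ from it. Around every station the plane is cut into $M\ge 1$ equal angular sections, whose path loss exponents are i.i.d. uniform on $[\mu-\sqrt3\sigma,\mu+\sqrt3\sigma]$, with $\sigma>0$ and $\mu-\sqrt3\sigma>2$. A link of length $\ell$ has path loss $\ell^{-\alpha}$, where $\alpha$ is the exponent of the section of the station that contains the user. Antenna gains are i.i.d. with $\Pr\{G=g_l\}=p_l$, where $$(g_1,g_2,g_3,g_4)=(M_tM_r,\,M_tm_r,\,m_tM_r,\,m_tm_r),$$ $$p_1=\tfrac{\phi_t}{2\pi}\tfrac{\phi_r}{2\pi},\quad p_2=\tfrac{\phi_t}{2\pi}\bigl(1-\tfrac{\phi_r}{2\pi}\bigr),\quad p_3=\bigl(1-\tfrac{\phi_t}{2\pi}\bigr)\tfrac{\phi_r}{2\pi},\quad p_4=\bigl(1-\tfrac{\phi_t}{2\pi}\bigr)\bigl(1-\tfrac{\phi_r}{2\pi}\bigr),$$ with lobe gains $M_t,M_r,m_t,m_r>0$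 and lobe widths $\phi_t,\phi_r\in[0,2\pi]$. Fading powers $h$ are i.i.d. exponential with mean $1$. Exponents, gains and fading powers are independent of one another and of $\Phi$. The power received from station $i$ is $P_i=P_TG_ih_i\ell_i^{-\alpha_i}$, with $P_T>0$. The SINR of the serving link is $$\frac{P_TM_tM_rh\,\ell^{-\alpha}}{I+\sigma_n^2},\qquad I=\sum_iP_i \text{ over the other stations.}$$ **Handoff probability.** The user moves a distance $vt\ge 0$ in direction $\varphi=\Theta^r$, that is, directly away from $\mathrm{SBS}^r$; exponents stay attached to the sections, and at the new location the gains and fading powers again have the distribution above. Event A2 is that the SINR of $\mathrm{SBS}^r$ at the new location is smaller than $\tau_h-\tau_{\mathrm{hys}}>0$. Let $\alpha_r$ be the exponent of the link from $\mathrm{SBS}^r$ to the origin, and let $P_A(r|\alpha_r)$ be the conditional probability, given $\alpha_r$, that $\mathrm{SBS}^r$ provides the maximum received power at the origin. The handoff probability is defined as $$P_H^0(vt)=\int_0^\infty\mathbb E_{\alpha_r}\bigl[\Pr\{\mathrm{A2}\mid\alpha_r\}\,P_A(r|\alpha_r)\bigr]\,dr .$$ **Theorem.** For every $r>0$, almost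 surely, $$\Pr\{\mathrm{A2}\mid\alpha_r\}=O(r,\alpha_r):=1-\exp\Bigl(-\tfrac{\tau_h-\tau_{\mathrm{hys}}}{P_TM_tM_r}\sigma_n^2(r+vt)^{\alpha_r}\Bigr)\exp\Bigl(-\tfrac{\lambda\pi^2}{\sqrt3\sigma}\sum_{l=1}^4p_l\int_{\mu-\sqrt3\sigma}^{\mu+\sqrt3\sigma}\Bigl(\tfrac{(\tau_h-\tau_{\mathrm{hys}})(r+vt)^{\alpha_r}g_l}{M_tM_r}\Bigr)^{2/\alpha}\tfrac{\csc(2\pi/\alpha)}{\alpha}\,d\alpha\Bigr)$$ and $$P_A(r|\alpha_r)=A(r,\alpha_r):=\sum_{m=1}^4p_m\int_0^\infty\exp\Bigl(-h-\tfrac{\lambda\pi}{\sqrt3\sigma}\sum_{n=1}^4p_n\int_{\mu-\sqrt3\sigma}^{\mu+\sqrt3\sigma}\Bigl(\tfrac{g_m}{g_n}hr^{-\alpha_r}\Bigr)^{-2/\alpha}\tfrac{\Gamma(2/\alpha)}{\alpha}\,d\alpha\Bigr)dh .$$ The integral defining $P_H^0(vt)$ converges, and $$P_H^0(vt)=\int_0^\infty\frac1{2\sqrt3\sigma}\int_{\mu-\sqrt3\sigma}^{\mu+\sqrt3\sigma}O(r,a)\,A(r,a)\,da\,dr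 .$$ -/

import Mathlib

open MeasureTheory ProbabilityTheory

noncomputable section

namespace SmallCell

/-- Numerical parameters of the network. -/
structure Params where
  /-- intensity of the base stations -/
  lam : ℝ
  /-- mean of the path loss exponents -/
  μ : ℝ
  /-- standard deviation of the path loss exponents -/
  σ : ℝ
  /-- transmission power -/
  PT : ℝ
  /-- the noise power is `σn ^ 2` -/
  σn : ℝ
  /-- main lobe gain of a base station -/
  Mt : ℝ
  /-- main lobe gain of the user -/
  Mr : ℝ
  /-- side lobe gain of a base station -/
  mt : ℝ
  /-- side lobe gain of the user -/
  mr : ℝ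
  /-- main lobe width of a base station -/
  φt : ℝ
  /-- main lobe width of the user -/
  φr : ℝ

namespace Params

/-- Smallest path loss exponent. -/
def αmin (p : Params) : ℝ := p.μ - √3 * p.σ

/-- Largest path loss exponent. -/
def αmax (p : Params) : ℝ := p.μ + √3 * p.σ

/-- The admissible range of the parameters; the smallest path loss exponent exceeds `2`. -/
structure Admissible (p : Params) : Prop where
  lam_pos : 0 < p.lam
  σ_pos : 0 < p.σ
  two_lt_αmin : 2 < p.αmin
  PT_pos : 0 < p.PT
  Mt_pos : 0 < p.Mt
  Mr_pos : 0 < p.Mr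
  mt_pos : 0 < p.mt
  mr_pos : 0 < p.mr
  φt_nonneg : 0 ≤ p.φt
  φt_le : p.φt ≤ 2 * Real.pi
  φr_nonneg : 0 ≤ p.φr
  φr_le : p.φr ≤ 2 * Real.pi

/-- The four values of the antenna gain of a link. -/
def g (p : Params) : Fin 4 → ℝ :=
  ![p.Mt * p.Mr, p.Mt * p.mr, p.mt * p.Mr, p.mt * p.mr]

/-- The probabilities of the four values of the antenna gain. -/
def prob (p : Params) : Fin 4 → ℝ :=
  ![p.φt / (2 * Real.pi) * (p.φr / (2 * Real.pi)),
    p.φt / (2 * Real.pi) * (1 - p.φr / (2 * Real.pi)),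
    (1 - p.φt / (2 * Real.pi)) * (p.φr / (2 * Real.pi)),
    (1 - p.φt / (2 * Real.pi)) * (1 - p.φr / (2 * Real.pi))]

/-- Law of the antenna gain. -/
def gainLaw (p : Params) : Measure ℝ :=
  ∑ l : Fin 4, ENNReal.ofReal (p.prob l) • Measure.dirac (p.g l)

/-- Law of one path loss exponent: uniform on `[μ - √3 σ, μ + √3 σ]`. -/
def exponentLaw (p : Params) : Measure ℝ :=
  ProbabilityTheory.cond volume (Set.Icc p.αmin p.αmax)

end Params

section PoissonProcess

variable {Ω : Type*} [MeasurableSpace Ω]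

/-- Number of points of the random configuration `x` that lie in `B`. -/
def count (x : ℕ → Ω → ℂ) (B : Set ℂ) (ω : Ω) : ℕ∞ := {i | x i ω ∈ B}.encard

/-- The points `x 0, x 1, …` form a homogeneous Poisson point process of intensity `lam` in the
plane: counts are Poisson with mean `lam` times the area, and independent over disjoint sets. -/
structure IsPoissonProcess (x : ℕ → Ω → ℂ) (lam : ℝ) (P : Measure Ω) : Prop where
  measurable : ∀ i, Measurable (x i)
  count_law : ∀ B : Set ℂ, MeasurableSet B → volume B ≠ ⊤ → ∀ k : ℕ,
    P {ω | count x B ω = k} = poissonMeasure (lam * (volume B).toReal).toNNReal {k}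
  count_indep : ∀ (n : ℕ) (B : Fin n → Set ℂ), (∀ j, MeasurableSet (B j)) →
    (∀ j, volume (B j) ≠ ⊤) → Pairwise (fun j k => Disjoint (B j) (B k)) →
    iIndepFun (fun j => count x (B j)) P

end PoissonProcess

/-- Angle in `[0, 2π)` of a vector of the plane. -/
def azimuth (z : ℂ) : ℝ := toIcoMod Real.two_pi_pos 0 (Complex.arg z)

/-- Section, out of `M` equal ones around a base station, that contains the direction `z`:
section `m` consists of the angles in `[2π m / M, 2π (m + 1) / M)`, for `m = 0, …, M - 1`. -/
def sectionIndex (M : ℕ) [NeZero M] (z : ℂ) : Fin M :=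
  Fin.ofNat M ⌊azimuth z * M / (2 * Real.pi)⌋₊

/-- Path loss exponent of the link from a base station at `s`, with exponents `a` in its `M`
sections, to a user at `u`. -/
def linkExponent {M : ℕ} [NeZero M] (a : Fin M → ℝ) (s u : ℂ) : ℝ :=
  a (sectionIndex M (u - s))

/-- Multi-directional path loss of that link. -/
def pathLoss {M : ℕ} [NeZero M] (a : Fin M → ℝ) (s u : ℂ) : ℝ :=
  ‖u - s‖ ^ (-linkExponent a s u)

/-- The random network. Station `none` is the serving base station, station `some i` is the
`i`-th other one, located at `x i`. Time `0` is the start of the movement, time `1` its end. -/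
structure Network (M : ℕ) (Ω : Type*) where
  /-- locations of the base stations other than the serving one -/
  x : ℕ → Ω → ℂ
  /-- path loss exponents of the `M` sections of each station -/
  α : Option ℕ → Ω → Fin M → ℝ
  /-- antenna gain of the link to each station, as an undesired link, at each time -/
  G : Fin 2 → Option ℕ → Ω → ℝ
  /-- fading power gain of the link to each station, at each time -/
  h : Fin 2 → Option ℕ → Ω → ℝ

namespace Network

variable {M : ℕ} {Ω : Type*}

/-- Everything random that belongs to one station at time `k`, apart from its location. -/
def mark (N : Network M Ω) (k : Fin 2) (i : Option ℕ) (ω : Ω) : (Fin M → ℝ) × ℝ × ℝ :=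
  (N.α i ω, N.G k i ω, N.h k i ω)

/-- Probabilistic assumptions: the other stations form a Poisson process of intensity `lam`; at
each of the two times the exponents of the sections (i.i.d. uniform), the gains (i.i.d.) and the
Rayleigh fading powers (i.i.d. exponential with mean `1`) of all stations are independent of one
another and of the locations. The section exponents do not change between the two times. No
assumption is needed on the joint law of the gains and fading powers of different times. -/
structure IsModel [MeasurableSpace Ω] (N : Network M Ω) (p : Params) (P : Measure Ω) : Prop where
  poisson : IsPoissonProcess N.x p.lam P
  measurable_mark : ∀ k i, Measurable (N.mark k i)
  mark_law : ∀ k i, P.map (N.mark k i) =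
    (Measure.pi fun _ : Fin M => p.exponentLaw).prod (p.gainLaw.prod (expMeasure 1))
  mark_indep : ∀ k, iIndepFun (N.mark k) P
  location_indep : ∀ k, IndepFun (fun ω i => N.x i ω) (fun ω i => N.mark k i ω) P

variable [NeZero M]

/-- Location of a serving base station at distance `r` from the origin, such that the vector from
the station to the origin has angle `Θ`. -/
def servingLocation (Θ r : ℝ) : ℂ := -(r * Complex.exp (Θ * Complex.I))

/-- Location of the user after moving a distance `d` from the origin in direction `φ`. -/
def newLocation (φ d : ℝ) : ℂ := d * Complex.exp (φ * Complex.I)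

/-- Power received at time `k` by a user at `u` from the `i`-th of the other stations. -/
def otherPower (N : Network M Ω) (p : Params) (k : Fin 2) (u : ℂ) (i : ℕ) (ω : Ω) : ℝ :=
  p.PT * N.G k (some i) ω * N.h k (some i) ω * pathLoss (N.α (some i) ω) (N.x i ω) u

/-- Aggregate interference at time `k` for a user at `u`. -/
def interference (N : Network M Ω) (p : Params) (k : Fin 2) (u : ℂ) (ω : Ω) : ENNReal :=
  ∑' i : ℕ, ENNReal.ofReal (N.otherPower p k u i ω)

/-- SINR at time `k` of the link from the serving station, located at `s`, to a user at `u`; the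
beams of the two are aligned. -/
def servingSINR (N : Network M Ω) (p : Params) (k : Fin 2) (s u : ℂ) (ω : Ω) : ENNReal :=
  ENNReal.ofReal (p.PT * p.Mt * p.Mr * N.h k none ω * pathLoss (N.α none ω) s u) /
    (N.interference p k u ω + ENNReal.ofReal (p.σn ^ 2))

/-- Path loss exponent `α_r` of the link at the start of the movement between the user, at the
origin, and a serving station at distance `r`. -/
def servingExponent (N : Network M Ω) (Θ r : ℝ) (ω : Ω) : ℝ :=
  linkExponent (N.α none ω) (servingLocation Θ r) 0

/-- Event A2: after a movement of length `d` in direction `φ`, the SINR of a serving station that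
was at distance `r` is smaller than `τh - τhys`. -/
def eventA2 (N : Network M Ω) (p : Params) (τh τhys Θ φ d r : ℝ) : Set Ω :=
  {ω | N.servingSINR p 1 (servingLocation Θ r) (newLocation φ d) ω < ENNReal.ofReal (τh - τhys)}

/-- Association at the start of the movement under the maximum received power criterion: no other
station is received at the origin with more power than the serving one at distance `r`. -/
def eventAssoc (N : Network M Ω) (p : Params) (Θ r : ℝ) : Set Ω :=
  {ω | ∀ i : ℕ, N.otherPower p 0 0 i ω ≤
    p.PT * N.G 0 none ω * N.h 0 none ω * pathLoss (N.α none ω) (servingLocation Θ r) 0}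

variable [MeasurableSpace Ω]

/-- Conditional probability, given `α_r`, that the event A2 occurs. -/
def condOutage (N : Network M Ω) (p : Params) (P : Measure Ω) (τh τhys Θ φ d r : ℝ) : Ω → ℝ :=
  P⟦N.eventA2 p τh τhys Θ φ d r |
    MeasurableSpace.comap (N.servingExponent Θ r) (inferInstance : MeasurableSpace ℝ)⟧

/-- Conditional association probability `P_A(r | α_r)`. -/
def condAssoc (N : Network M Ω) (p : Params) (P : Measure Ω) (Θ r : ℝ) : Ω → ℝ :=
  P⟦N.eventAssoc p Θ r |
    MeasurableSpace.comap (N.servingExponent Θ r) (inferInstance : MeasurableSpace ℝ)⟧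

/-- The expectation over `α_r` of `Pr{A2 | α_r} * P_A(r | α_r)`. -/
def handoffDensity (N : Network M Ω) (p : Params) (P : Measure Ω) (τh τhys Θ φ d r : ℝ) : ℝ :=
  ∫ ω, N.condOutage p P τh τhys Θ φ d r ω * N.condAssoc p P Θ r ω ∂P

/-- Handoff probability `P_H` for a movement of length `d` in direction `φ`. -/
def handoffProb (N : Network M Ω) (p : Params) (P : Measure Ω) (τh τhys Θ φ d : ℝ) : ℝ :=
  ∫ r in Set.Ioi (0 : ℝ), N.handoffDensity p P τh τhys Θ φ d r

end Network

namespace Params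

/-- Closed form of the outage probability at distance `R` for the SINR threshold `τ`, given the
path loss exponent `a` of the serving link. -/
def outageFormula (p : Params) (τ R a : ℝ) : ℝ :=
  1 - Real.exp (-(τ / (p.PT * p.Mt * p.Mr) * p.σn ^ 2 * R ^ a)) *
    Real.exp (-(p.lam * Real.pi ^ 2 / (√3 * p.σ) * ∑ l : Fin 4, p.prob l *
      ∫ α in p.αmin..p.αmax,
        (τ * R ^ a * p.g l / (p.Mt * p.Mr)) ^ (2 / α) * (Real.sin (2 * Real.pi / α))⁻¹ / α))

/-- Closed form of the association probability at distance `r`, given the path loss exponent `a`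
of the serving link. -/
def assocFormula (p : Params) (r a : ℝ) : ℝ :=
  ∑ m : Fin 4, p.prob m * ∫ h in Set.Ioi (0 : ℝ),
    Real.exp (-h - p.lam * Real.pi / (√3 * p.σ) * ∑ n : Fin 4, p.prob n *
      ∫ α in p.αmin..p.αmax,
        (p.g m / p.g n * h * r ^ (-a)) ^ (-2 / α) * Real.Gamma (2 / α) / α)

end Params

end SmallCell

end

/-!
Everything rests on the Laplace functional of the Poisson process of base stations. For step
functions it is the product of the generating functions of independent Poisson counts, and monotone
approximation gives `E exp (-∑ u (x i)) = exp (-lam ∫ (1 - exp (-u)))` for every measurable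
`u ≥ 0` (`IsPoissonProcess.lintegral_expNeg_tsum`). Integrating out i.i.d. marks first turns this
into the functional of the marked process (`IsPoissonProcess.lintegral_expNeg_tsum_marked`). All of
this is done with values in `[0, ∞]`, so that no integrability has to be checked.

An interferer at a fixed location shows the user exactly one of its sections, and the exponent of
that section is uniform; the number of sections therefore disappears, and the average over the plane
of a function of the received power reduces to areas of discs,
`area {z | E < w * ‖z‖ ^ (-a)} = π (w / E) ^ (2 / a)`. Two choices of the function matter.

* The Laplace transform of the interference (`IsModel.lintegral_expNeg_interference`): since
  `1 - exp (-c)` is the probability that an exponential variable is less than `c`, the average is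
  a mixture of such areas, and the moments of the two exponential variables give
  `Γ (1 + 2 / a) Γ (1 - 2 / a)`, a multiple of `csc (2 π / a)` by the reflection formula. As the
  fading of the serving link is exponential, the probability that the SINR is at least `τ` is this
  transform, times the contribution of the noise.
* The void probability (`IsModel.measure_forall_otherPower_le`): no interferer is received with
  power above `T`. Here a single moment `Γ (1 + 2 / a)` appears, and averaging over the gain and the
  fading of the serving link gives the association probability.

The exponent of the serving section is independent of all the other variables, so conditioning on it
only freezes its value (`condExp_indicator_ae_eq_of_indepFun`). Moving directly away from the
serving station keeps the user in the same section, hence the outage event involves the exponent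
`α_r` of the start of the movement.

The handoff integral converges because the outage probability is at most `1` and the association
probability at distance `r` is at most a constant times `r ^ (-a)`, with `a` greater than `2`
(`Params.Admissible.exists_assocFormula_le`).
-/

open Filter Set
open scoped ENNReal NNReal Topology

noncomputable section

namespace SmallCell

/-! ### The exponential `u ↦ exp (-u)` on `[0, ∞]` -/

/-- The function `u ↦ exp (-u)` on `[0, ∞]`, with value `0` at `∞`. Taking values in `[0, ∞]` as
well, it lets Laplace functionals be computed as lower Lebesgue integrals, without integrability
side conditions. -/
def expNeg (u : ℝ≥0∞) : ℝ≥0∞ := EReal.exp (-(u : EReal))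

@[simp] lemma expNeg_zero : expNeg 0 = 1 := by simp [expNeg]

@[simp] lemma expNeg_top : expNeg ⊤ = 0 := by simp [expNeg]

lemma expNeg_ofReal {x : ℝ} (hx : 0 ≤ x) :
    expNeg (ENNReal.ofReal x) = ENNReal.ofReal (Real.exp (-x)) := by
  rw [expNeg, EReal.coe_ennreal_ofReal, max_eq_left hx, ← EReal.coe_neg, EReal.exp_coe]

lemma expNeg_eq_inv (u : ℝ≥0∞) : expNeg u = (EReal.exp u)⁻¹ := EReal.exp_neg _

lemma expNeg_add (u v : ℝ≥0∞) : expNeg (u + v) = expNeg u * expNeg v := by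
  rw [expNeg_eq_inv, expNeg_eq_inv, expNeg_eq_inv, EReal.coe_ennreal_add, EReal.exp_add]
  apply ENNReal.mul_inv
  · left; simp
  · right; simp

lemma expNeg_antitone : Antitone expNeg := by
  intro u v h
  exact EReal.exp_monotone (EReal.neg_le_neg_iff.2 (EReal.coe_ennreal_le_coe_ennreal_iff.2 h))

lemma expNeg_le_one (u : ℝ≥0∞) : expNeg u ≤ 1 := by
  simpa using expNeg_antitone (zero_le : 0 ≤ u)

lemma continuous_expNeg : Continuous expNeg :=
  ENNReal.continuous_exp.comp (continuous_neg.comp continuous_coe_ennreal_ereal)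

lemma measurable_expNeg : Measurable expNeg := continuous_expNeg.measurable

@[fun_prop]
lemma _root_.Measurable.expNeg {α : Type*} [MeasurableSpace α] {f : α → ℝ≥0∞} (hf : Measurable f) :
    Measurable fun a => expNeg (f a) := measurable_expNeg.comp hf

lemma expNeg_sum {ι : Type*} (s : Finset ι) (u : ι → ℝ≥0∞) :
    expNeg (∑ i ∈ s, u i) = ∏ i ∈ s, expNeg (u i) := by
  classical
  induction s using Finset.induction_on with
  | empty => simp
  | insert a s ha ih => rw [Finset.sum_insert ha, Finset.prod_insert ha, expNeg_add, ih]

lemma expNeg_mul_natCast (c : ℝ≥0∞) (k : ℕ) : expNeg (c * k) = expNeg c ^ k := by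
  induction k with
  | zero => simp
  | succ k ih => rw [Nat.cast_add, mul_add, expNeg_add, ih, pow_succ]; simp

lemma tendsto_expNeg_tsum (u : ℕ → ℝ≥0∞) :
    Tendsto (fun n => expNeg (∑ i ∈ Finset.range n, u i)) atTop (𝓝 (expNeg (∑' i, u i))) :=
  (continuous_expNeg.tendsto _).comp ENNReal.summable.hasSum.tendsto_sum_nat

/-- The inverse of `expNeg`, namely `-log`, on `[0, 1]`. -/
def negLog (z : ℝ≥0∞) : ℝ≥0∞ := (-(ENNReal.log z)).toENNReal

lemma measurable_negLog : Measurable negLog :=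
  (ENNReal.measurable_log.neg).ereal_toENNReal

lemma expNeg_negLog {z : ℝ≥0∞} (hz : z ≤ 1) : expNeg (negLog z) = z := by
  have h : ENNReal.log z ≤ 0 := by simpa using ENNReal.log_monotone hz
  rw [expNeg, negLog, EReal.coe_toENNReal (by simpa using EReal.neg_le_neg_iff.2 h), neg_neg,
    ENNReal.exp_log]

/-! ### The Laplace functional of a Poisson process -/

/-- The probability generating function of the Poisson distribution. -/
lemma tsum_poissonMeasure_mul_pow (m : ℝ≥0) {z : ℝ≥0∞} (hz : z ≤ 1) :
    ∑' k : ℕ, z ^ k * poissonMeasure m {k} = expNeg (m * (1 - z)) := by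
  obtain ⟨w, rfl⟩ : ∃ w : ℝ≥0, z = w := ⟨z.toNNReal, by
    rw [ENNReal.coe_toNNReal (hz.trans_lt ENNReal.one_lt_top).ne]⟩
  have hw : (w : ℝ) ≤ 1 := by exact_mod_cast hz
  have hs : HasSum (fun k : ℕ => Real.exp (-m) * ((m * w : ℝ) ^ k / k.factorial))
      (Real.exp (-m) * Real.exp (m * w)) := by
    have := (NormedSpace.expSeries_div_hasSum_exp (m * w : ℝ)).mul_left (Real.exp (-m))
    rwa [← Real.exp_eq_exp_ℝ] at this
  have e : ((m : ℝ≥0∞) * (1 - (w : ℝ≥0∞))) = ENNReal.ofReal (m * (1 - w)) := by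
    rw [ENNReal.ofReal_mul (by positivity), ENNReal.ofReal_sub _ (by positivity)]
    simp
  rw [e, expNeg_ofReal (mul_nonneg (by positivity) (by linarith))]
  rw [show Real.exp (-(m * (1 - w))) = Real.exp (-m) * Real.exp (m * w) by
    rw [← Real.exp_add]; ring_nf]
  rw [← hs.tsum_eq, ENNReal.ofReal_tsum_of_nonneg (fun k => by positivity) hs.summable]
  congr 1 with k
  rw [poissonMeasure_singleton, ← ENNReal.ofReal_coe_nnreal, ← ENNReal.ofReal_pow (by positivity),
    ← ENNReal.ofReal_mul (by positivity)]
  congr 1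
  rw [mul_pow]
  ring

lemma tsum_indicator_eq_count {Ω : Type*} (x : ℕ → Ω → ℂ) (B : Set ℂ) (ω : Ω) :
    ∑' i, B.indicator (fun _ => (1 : ℝ≥0∞)) (x i ω) = (count x B ω : ℝ≥0∞) := by
  rw [count, ← ENNReal.tsum_set_one, tsum_subtype _ fun _ => (1 : ℝ≥0∞)]
  rfl

section PoissonProcess

variable {Ω : Type*} [MeasurableSpace Ω] {P : Measure Ω} {x : ℕ → Ω → ℂ} {lam : ℝ}

lemma IsPoissonProcess.measurable_count (hx : IsPoissonProcess x lam P) {B : Set ℂ}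
    (hB : MeasurableSet B) : Measurable (count x B) := by
  have h : Measurable fun ω => (count x B ω : ℝ≥0∞) := by
    simp_rw [← tsum_indicator_eq_count]
    exact Measurable.tsum fun i =>
      (measurable_const.indicator hB).comp (hx.measurable i)
  refine measurable_to_countable' fun k => ?_
  convert h (measurableSet_singleton (k : ℝ≥0∞)) using 1
  ext ω
  simp

lemma IsPoissonProcess.map_count [IsProbabilityMeasure P] (hx : IsPoissonProcess x lam P)
    {B : Set ℂ} (hB : MeasurableSet B) (hB' : volume B ≠ ⊤) :
    P.map (count x B) =
      (poissonMeasure (lam * (volume B).toReal).toNNReal).map (Nat.cast : ℕ → ℕ∞) := by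
  set Q := poissonMeasure (lam * (volume B).toReal).toNNReal
  have hm := hx.measurable_count hB
  have : IsProbabilityMeasure (P.map (count x B)) :=
    Measure.isProbabilityMeasure_map hm.aemeasurable
  have : IsProbabilityMeasure (Q.map (Nat.cast : ℕ → ℕ∞)) :=
    Measure.isProbabilityMeasure_map (by fun_prop)
  have hnat : ∀ k : ℕ, P.map (count x B) {(k : ℕ∞)} = Q.map (Nat.cast : ℕ → ℕ∞) {(k : ℕ∞)} := by
    intro k
    rw [Measure.map_apply hm (measurableSet_singleton _),
      Measure.map_apply (by fun_prop) (measurableSet_singleton _)]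
    have h1 : (Nat.cast : ℕ → ℕ∞) ⁻¹' {(k : ℕ∞)} = {k} := by ext; simp
    rw [h1, ← hx.count_law B hB hB' k]
    rfl
  refine Measure.ext_of_singleton fun k => ?_
  induction k using ENat.recTopCoe with
  | coe k => exact hnat k
  | top =>
    have hc : ({⊤} : Set ℕ∞) = (⋃ k : ℕ, {(k : ℕ∞)})ᶜ := by
      ext j
      induction j using ENat.recTopCoe <;> simp
    have hd : Pairwise (Function.onFun Disjoint fun k : ℕ => ({(k : ℕ∞)} : Set ℕ∞)) := by
      intro i j hij
      simpa [Function.onFun] using hij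
    rw [hc, prob_compl_eq_one_sub (MeasurableSet.of_discrete),
      prob_compl_eq_one_sub (MeasurableSet.of_discrete),
      measure_iUnion hd (fun _ => MeasurableSet.of_discrete),
      measure_iUnion hd (fun _ => MeasurableSet.of_discrete)]
    simp_rw [hnat]

lemma IsPoissonProcess.lintegral_expNeg_mul_count [IsProbabilityMeasure P]
    (hx : IsPoissonProcess x lam P) (hlam : 0 ≤ lam) {B : Set ℂ} (hB : MeasurableSet B)
    (hB' : volume B ≠ ⊤) (c : ℝ≥0∞) :
    ∫⁻ ω, expNeg (c * (count x B ω : ℝ≥0∞)) ∂P =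
      expNeg (ENNReal.ofReal lam * ((1 - expNeg c) * volume B)) := by
  have h1 : ∫⁻ ω, expNeg (c * (count x B ω : ℝ≥0∞)) ∂P =
      ∫⁻ k, expNeg (c * ((k : ℕ∞) : ℝ≥0∞)) ∂(P.map (count x B)) :=
    (lintegral_map (f := fun k : ℕ∞ => expNeg (c * (k : ℝ≥0∞))) (measurable_of_countable _)
      (hx.measurable_count hB)).symm
  rw [h1, hx.map_count hB hB', lintegral_map (measurable_of_countable _) (by fun_prop),
    lintegral_countable']
  simp_rw [ENat.toENNReal_coe, expNeg_mul_natCast]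
  rw [tsum_poissonMeasure_mul_pow _ (expNeg_le_one c)]
  congr 1
  rw [mul_comm (1 - expNeg c), ← mul_assoc]
  congr 1
  change ENNReal.ofReal (lam * (volume B).toReal) = _
  rw [ENNReal.ofReal_mul hlam, ENNReal.ofReal_toReal hB']

/-- The Laplace functional of a Poisson process for step functions: independence over disjoint
sets reduces it to the Laplace transforms of single counts. -/
lemma IsPoissonProcess.lintegral_expNeg_sum_mul_count [IsProbabilityMeasure P]
    (hx : IsPoissonProcess x lam P) (hlam : 0 ≤ lam) {ι : Type*} [Fintype ι] {B : ι → Set ℂ}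
    (hB : ∀ j, MeasurableSet (B j)) (hB' : ∀ j, volume (B j) ≠ ⊤)
    (hd : Pairwise fun j k => Disjoint (B j) (B k)) (c : ι → ℝ≥0∞) :
    ∫⁻ ω, expNeg (∑ j, c j * (count x (B j) ω : ℝ≥0∞)) ∂P =
      expNeg (ENNReal.ofReal lam * ∑ j, (1 - expNeg (c j)) * volume (B j)) := by
  have e := Fintype.equivFin ι
  have hind : iIndepFun (fun j => count x (B j)) P := by
    have h := hx.count_indep _ (fun j => B (e.symm j)) (fun j => hB _) (fun j => hB' _)
      (fun j k hjk => hd (e.symm.injective.ne hjk))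
    simpa using h.precomp e.injective
  have hind' := hind.comp (fun j k => expNeg (c j * ((k : ℕ∞) : ℝ≥0∞)))
    (fun j => measurable_of_countable _)
  simp_rw [expNeg_sum]
  have h := lintegral_prod_eq_prod_lintegral_of_indepFun Finset.univ _ hind'
    (fun j => (measurable_of_countable _).comp (hx.measurable_count (hB j)))
  refine h.trans ?_
  rw [Finset.mul_sum, expNeg_sum]
  exact Finset.prod_congr rfl fun j _ => hx.lintegral_expNeg_mul_count hlam (hB j) (hB' j) (c j)

lemma IsPoissonProcess.lintegral_expNeg_tsum_simpleFunc [IsProbabilityMeasure P]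
    (hx : IsPoissonProcess x lam P) (hlam : 0 ≤ lam) (s : SimpleFunc ℂ ℝ≥0∞)
    (hs : ∀ c, c ≠ 0 → volume (s ⁻¹' {c}) ≠ ⊤) :
    ∫⁻ ω, expNeg (∑' i, s (x i ω)) ∂P =
      expNeg (ENNReal.ofReal lam * ∫⁻ z, (1 - expNeg (s z))) := by
  classical
  set T := s.range.erase 0
  have key := hx.lintegral_expNeg_sum_mul_count hlam (ι := T) (B := fun c => s ⁻¹' {(c : ℝ≥0∞)})
    (fun c => s.measurableSet_fiber _) (fun c => hs _ (Finset.ne_of_mem_erase c.2))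
    (fun c d hcd => Disjoint.preimage _
      (disjoint_singleton.2 fun h => hcd (Subtype.ext h)))
    (fun c => (c : ℝ≥0∞))
  -- a function of `s z` that vanishes at `0` is a sum over the nonzero values of `s`
  have hval : ∀ (f : ℝ≥0∞ → ℝ≥0∞), f 0 = 0 → ∀ z,
      f (s z) = ∑ c : T, f c * (s ⁻¹' {(c : ℝ≥0∞)}).indicator (fun _ => 1) z := by
    intro f hf z
    rw [Finset.sum_coe_sort T (fun c => f c * (s ⁻¹' {c}).indicator (fun _ => (1 : ℝ≥0∞)) z)]
    by_cases hz : s z = 0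
    · rw [hz, hf, Finset.sum_eq_zero]
      intro c hc
      have : z ∉ s ⁻¹' {c} := by
        simp only [mem_preimage, mem_singleton_iff, hz]
        exact (Finset.ne_of_mem_erase hc).symm
      simp [this]
    · rw [Finset.sum_eq_single (s z)]
      · simp
      · intro c _ hc
        have : z ∉ s ⁻¹' {c} := by simpa using hc.symm
        simp [this]
      · intro h
        exact absurd (Finset.mem_erase.2 ⟨hz, s.mem_range_self z⟩) h
  have h1 : ∀ ω, ∑' i, s (x i ω) =
      ∑ c : T, (c : ℝ≥0∞) * (count x (s ⁻¹' {(c : ℝ≥0∞)}) ω : ℝ≥0∞) := by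
    intro ω
    have : ∀ i, s (x i ω) =
        ∑ c : T, (c : ℝ≥0∞) * (s ⁻¹' {(c : ℝ≥0∞)}).indicator (fun _ => 1) (x i ω) :=
      fun i => hval id rfl _
    simp_rw [this, ← tsum_indicator_eq_count, ← ENNReal.tsum_mul_left]
    exact Summable.tsum_finsetSum fun _ _ => ENNReal.summable
  have h2 : ∫⁻ z, (1 - expNeg (s z)) =
      ∑ c : T, (1 - expNeg c) * volume (s ⁻¹' {(c : ℝ≥0∞)}) := by
    simp_rw [hval (fun c => 1 - expNeg c) (by simp)]
    rw [lintegral_finsetSum]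
    · refine Finset.sum_congr rfl fun c _ => ?_
      rw [lintegral_const_mul _ (measurable_const.indicator (s.measurableSet_fiber _)),
        lintegral_indicator (s.measurableSet_fiber _)]
      simp
    · intro c _
      exact (measurable_const.indicator (s.measurableSet_fiber _)).const_mul _
  simp_rw [h1, h2]
  exact key

/-- The Laplace functional of a Poisson process:
`E exp (-∑ u (x i)) = exp (-lam ∫ (1 - exp (-u)))` for every measurable `u ≥ 0`. -/
theorem IsPoissonProcess.lintegral_expNeg_tsum [IsProbabilityMeasure P]
    (hx : IsPoissonProcess x lam P) (hlam : 0 ≤ lam) {u : ℂ → ℝ≥0∞} (hu : Measurable u) :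
    ∫⁻ ω, expNeg (∑' i, u (x i ω)) ∂P =
      expNeg (ENNReal.ofReal lam * ∫⁻ z, (1 - expNeg (u z))) := by
  -- simple functions with bounded support that increase to `u`
  set s : ℕ → SimpleFunc ℂ ℝ≥0∞ := fun n =>
    (SimpleFunc.eapprox u n).restrict (Metric.ball 0 n)
  have hsval : ∀ n z, s n z = (Metric.ball (0 : ℂ) n).indicator (SimpleFunc.eapprox u n) z :=
    fun n z => SimpleFunc.restrict_apply _ Metric.isOpen_ball.measurableSet z
  have hmono : ∀ z, Monotone fun n => s n z := by
    intro z n m hnm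
    simp only [hsval]
    refine (indicator_le_indicator (SimpleFunc.monotone_eapprox u hnm z)).trans ?_
    exact indicator_le_indicator_of_subset
      (Metric.ball_subset_ball (by exact_mod_cast hnm)) (fun _ => zero_le) z
  have hlim : ∀ z, Tendsto (fun n => s n z) atTop (𝓝 (u z)) := by
    intro z
    have h1 : Tendsto (fun n => SimpleFunc.eapprox u n z) atTop (𝓝 (u z)) :=
      SimpleFunc.tendsto_eapprox hu z
    refine h1.congr' ?_
    obtain ⟨k, hk⟩ := exists_nat_gt ‖z‖
    filter_upwards [eventually_ge_atTop k] with n hn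
    rw [hsval, indicator_of_mem]
    simpa using hk.trans_le (by exact_mod_cast hn)
  have hfin : ∀ n c, c ≠ 0 → volume (s n ⁻¹' {c}) ≠ ⊤ := by
    intro n c hc
    refine ne_top_of_le_ne_top (measure_ball_lt_top (x := (0 : ℂ)) (r := n)).ne
      (measure_mono fun z hz => ?_)
    by_contra h
    rw [mem_preimage, mem_singleton_iff, hsval, indicator_of_notMem h] at hz
    exact hc hz.symm
  have hstep := fun n => hx.lintegral_expNeg_tsum_simpleFunc hlam (s n) (hfin n)
  have hL : Tendsto (fun n => ∫⁻ ω, expNeg (∑' i, s n (x i ω)) ∂P) atTop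
      (𝓝 (∫⁻ ω, expNeg (∑' i, u (x i ω)) ∂P)) := by
    refine tendsto_lintegral_of_dominated_convergence (fun _ => 1) (fun n => ?_)
      (fun n => ae_of_all _ fun ω => expNeg_le_one _) (by simp) (ae_of_all _ fun ω => ?_)
    · exact (Measurable.tsum fun i => (s n).measurable.comp (hx.measurable i)).expNeg
    · refine (continuous_expNeg.tendsto _).comp ?_
      have h := lintegral_tendsto_of_tendsto_of_monotone (μ := Measure.count)
        (f := fun n i => s n (x i ω)) (F := fun i => u (x i ω))
        (fun n => (measurable_of_countable _).aemeasurable)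
        (ae_of_all _ fun i => hmono _) (ae_of_all _ fun i => hlim _)
      simpa [lintegral_count] using h
  have hR : Tendsto (fun n => expNeg (ENNReal.ofReal lam * ∫⁻ z, (1 - expNeg (s n z)))) atTop
      (𝓝 (expNeg (ENNReal.ofReal lam * ∫⁻ z, (1 - expNeg (u z))))) := by
    refine (continuous_expNeg.tendsto _).comp
      (ENNReal.Tendsto.const_mul ?_ (Or.inr ENNReal.ofReal_ne_top))
    refine lintegral_tendsto_of_tendsto_of_monotone
      (fun n => ((s n).measurable.expNeg.const_sub 1).aemeasurable)
      (ae_of_all _ fun z n m hnm => ?_) (ae_of_all _ fun z => ?_)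
    · exact tsub_le_tsub_left (expNeg_antitone (hmono z hnm)) 1
    · exact ENNReal.Tendsto.sub tendsto_const_nhds
        ((continuous_expNeg.tendsto _).comp (hlim z)) (Or.inl ENNReal.one_ne_top)
  simp_rw [hstep] at hL
  exact tendsto_nhds_unique hL hR

end PoissonProcess

/-! ### Independence and conditioning -/

section Independence

variable {Ω A B C : Type*} [MeasurableSpace Ω] [MeasurableSpace A] [MeasurableSpace B]
  [MeasurableSpace C] {P : Measure Ω} [IsProbabilityMeasure P]

lemma lintegral_comp_prodMk_of_indepFun {X : Ω → A} {Y : Ω → B} (hX : Measurable X)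
    (hY : Measurable Y) (h : IndepFun X Y P) {f : A × B → ℝ≥0∞} (hf : Measurable f) :
    ∫⁻ ω, f (X ω, Y ω) ∂P = ∫⁻ ω, ∫⁻ ω', f (X ω, Y ω') ∂P ∂P := by
  have := Measure.isProbabilityMeasure_map (μ := P) hY.aemeasurable
  rw [← lintegral_map (f := f) hf (hX.prodMk hY),
    (indepFun_iff_map_prod_eq_prod_map_map hX.aemeasurable hY.aemeasurable).1 h,
    lintegral_prod _ hf.aemeasurable, lintegral_map hf.lintegral_prod_right' hX]
  refine lintegral_congr fun ω => ?_
  rw [lintegral_map (f := fun y => f (X ω, y)) (by fun_prop) hY]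

lemma measure_prodMk_mem_of_indepFun {X : Ω → A} {Y : Ω → B} (hX : Measurable X)
    (hY : Measurable Y) (h : IndepFun X Y P) {S : Set (A × B)} (hS : MeasurableSet S) :
    P {ω | (X ω, Y ω) ∈ S} = ∫⁻ ω, P {ω' | (X ω, Y ω') ∈ S} ∂P := by
  have h1 := lintegral_comp_prodMk_of_indepFun hX hY h (measurable_one.indicator hS)
  rw [← lintegral_indicator_one (show MeasurableSet {ω | (X ω, Y ω) ∈ S} from (hX.prodMk hY) hS)]
  refine h1.trans (lintegral_congr fun ω => ?_)
  rw [← lintegral_indicator_one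
    (show MeasurableSet {ω' | (X ω, Y ω') ∈ S} from (measurable_const.prodMk hY) hS)]
  rfl

/-- If `X` is independent of the pair `(Y, Z)` and `Y` of `Z`, then `Y` is independent of
`(X, Z)`. -/
lemma indepFun_prodMk_of_indepFun {X : Ω → A} {Y : Ω → B} {Z : Ω → C} (hX : Measurable X)
    (hY : Measurable Y) (hZ : Measurable Z) (h : IndepFun X (fun ω => (Y ω, Z ω)) P)
    (h' : IndepFun Y Z P) : IndepFun Y (fun ω => (X ω, Z ω)) P := by
  have hXZ : IndepFun X Z P := h.comp measurable_id measurable_snd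
  rw [indepFun_iff_map_prod_eq_prod_map_map hY.aemeasurable (hX.prodMk hZ).aemeasurable]
  have := Measure.isProbabilityMeasure_map (μ := P) (hX.prodMk hZ).aemeasurable
  have := Measure.isProbabilityMeasure_map (μ := P) hY.aemeasurable
  refine Measure.ext_of_lintegral _ fun f hf => ?_
  rw [lintegral_map hf (by fun_prop), lintegral_prod _ hf.aemeasurable,
    lintegral_map hf.lintegral_prod_right' hY]
  calc ∫⁻ ω, f (Y ω, X ω, Z ω) ∂P
      = ∫⁻ ω, ∫⁻ ω', f (Y ω', X ω, Z ω') ∂P ∂P :=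
        lintegral_comp_prodMk_of_indepFun (f := fun q : A × B × C => f (q.2.1, q.1, q.2.2)) hX
          (hY.prodMk hZ) h (by fun_prop)
    _ = ∫⁻ ω, ∫⁻ ω', ∫⁻ ω'', f (Y ω', X ω, Z ω'') ∂P ∂P ∂P := by
        refine lintegral_congr fun ω => ?_
        exact lintegral_comp_prodMk_of_indepFun (f := fun q : B × C => f (q.1, X ω, q.2)) hY hZ h'
          (by fun_prop)
    _ = ∫⁻ ω', ∫⁻ ω, ∫⁻ ω'', f (Y ω', X ω, Z ω'') ∂P ∂P ∂P := by
        refine lintegral_lintegral_swap (Measurable.aemeasurable ?_)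
        refine Measurable.lintegral_prod_right'
          (f := fun q : (Ω × Ω) × Ω => f (Y q.1.2, X q.1.1, Z q.2)) ?_
        fun_prop
    _ = _ := by
        refine lintegral_congr fun ω' => ?_
        rw [lintegral_map (f := fun y => f (Y ω', y)) (by fun_prop) (hX.prodMk hZ)]
        exact (lintegral_comp_prodMk_of_indepFun (f := fun q : A × C => f (Y ω', q.1, q.2)) hX hZ
          hXZ (by fun_prop)).symm

/-- Conditioning on `X` an event that depends on `X` and on an independent variable `W` amounts to
freezing the value of `X`. -/
lemma condExp_indicator_ae_eq_of_indepFun {X : Ω → A} {W : Ω → B} (hX : Measurable X)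
    (hW : Measurable W) (h : IndepFun X W P) {E : Set (A × B)} (hE : MeasurableSet E) :
    P⟦{ω | (X ω, W ω) ∈ E} | MeasurableSpace.comap X inferInstance⟧ =ᵐ[P]
      fun ω => (P {ω' | (X ω, W ω') ∈ E}).toReal := by
  have hm : MeasurableSpace.comap X inferInstance ≤ (inferInstance : MeasurableSpace Ω) :=
    hX.comap_le
  have hEm : MeasurableSet {ω | (X ω, W ω) ∈ E} := (hX.prodMk hW) hE
  have hg : Measurable fun a => P {ω' | (a, W ω') ∈ E} :=
    measurable_measure_prodMk_left (ν := P) (s := {q : A × Ω | (q.1, W q.2) ∈ E})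
      (by exact (measurable_fst.prodMk (hW.comp measurable_snd)) hE)
  have hgX : Measurable fun ω => (P {ω' | (X ω, W ω') ∈ E}).toReal :=
    (hg.comp hX).ennreal_toReal
  have hbd : ∀ ω, ‖(P {ω' | (X ω, W ω') ∈ E}).toReal‖ ≤ 1 := fun ω => by
    rw [Real.norm_of_nonneg ENNReal.toReal_nonneg]
    exact ENNReal.toReal_le_of_le_ofReal zero_le_one (by simpa using prob_le_one)
  refine (ae_eq_condExp_of_forall_setIntegral_eq hm ?_ ?_ ?_ ?_).symm
  · exact (integrable_const (1 : ℝ)).indicator hEm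
  · intro s _ _
    exact (Integrable.of_bound hgX.aestronglyMeasurable 1 (ae_of_all _ hbd)).integrableOn
  · rintro s ⟨S, hS, rfl⟩ -
    have hs : MeasurableSet (X ⁻¹' S) := hX hS
    rw [integral_indicator hEm, setIntegral_const, smul_eq_mul, mul_one, measureReal_def,
      Measure.restrict_apply hEm,
      integral_toReal (f := fun ω => P {ω' | (X ω, W ω') ∈ E}) (hg.comp hX).aemeasurable
        (ae_of_all _ fun ω => measure_lt_top _ _)]
    congr 1
    have key := measure_prodMk_mem_of_indepFun hX hW h (hE.inter (measurable_fst hS))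
    rw [← lintegral_indicator hs]
    refine Eq.trans (lintegral_congr fun ω => ?_) key.symm
    by_cases hω : X ω ∈ S
    · rw [indicator_of_mem (show ω ∈ X ⁻¹' S from hω)]
      congr 1
      ext ω'
      exact (and_iff_left hω).symm
    · rw [indicator_of_notMem (show ω ∉ X ⁻¹' S from hω)]
      symm
      convert measure_empty (μ := P)
      exact eq_empty_of_forall_notMem fun ω' h' => hω h'.2
  · exact StronglyMeasurable.aestronglyMeasurable (Measurable.stronglyMeasurable
      ((hg.comp (comap_measurable X)).ennreal_toReal))

end Independence

/-! ### The Laplace functional of a marked Poisson process -/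

/-- The Laplace functional of a Poisson process with i.i.d. marks of law `ν`. Given the locations,
the expectation of the product of the factors `exp (-u (x i, m i))` factorizes, which leaves the
Laplace functional of the unmarked process at `z ↦ -log ∫ exp (-u (z, e)) dν(e)`. -/
theorem IsPoissonProcess.lintegral_expNeg_tsum_marked {Ω E : Type*} [MeasurableSpace Ω]
    [MeasurableSpace E] {P : Measure Ω} [IsProbabilityMeasure P] {x : ℕ → Ω → ℂ} {lam : ℝ}
    (hx : IsPoissonProcess x lam P) (hlam : 0 ≤ lam) {m : ℕ → Ω → E} (hm : ∀ i, Measurable (m i))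
    {ν : Measure E} (hν : ∀ i, P.map (m i) = ν) (hind : iIndepFun m P)
    (hxm : IndepFun (fun ω i => x i ω) (fun ω i => m i ω) P) {u : ℂ × E → ℝ≥0∞}
    (hu : Measurable u) :
    ∫⁻ ω, expNeg (∑' i, u (x i ω, m i ω)) ∂P =
      expNeg (ENNReal.ofReal lam * ∫⁻ z, ∫⁻ e, (1 - expNeg (u (z, e))) ∂ν) := by
  have hνp : IsProbabilityMeasure ν := by
    rw [← hν 0]; exact Measure.isProbabilityMeasure_map (hm 0).aemeasurable
  set F : ℂ → ℝ≥0∞ := fun z => ∫⁻ e, expNeg (u (z, e)) ∂ν with hF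
  have hFm : Measurable F := hu.expNeg.lintegral_prod_right'
  have hF1 : ∀ z, F z ≤ 1 := fun z => by
    calc F z ≤ ∫⁻ _, 1 ∂ν := lintegral_mono fun e => expNeg_le_one _
      _ = 1 := by simp
  have hxmeas : Measurable fun ω i => x i ω := measurable_pi_lambda _ hx.measurable
  have hmmeas : Measurable fun ω i => m i ω := measurable_pi_lambda _ hm
  have hfin : ∀ n : ℕ, ∫⁻ ω, expNeg (∑ i ∈ Finset.range n, u (x i ω, m i ω)) ∂P =
      ∫⁻ ω, expNeg (∑ i ∈ Finset.range n, negLog (F (x i ω))) ∂P := by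
    intro n
    simp_rw [expNeg_sum, fun z => expNeg_negLog (hF1 z)]
    refine (lintegral_comp_prodMk_of_indepFun hxmeas hmmeas hxm
      (f := fun q => ∏ i ∈ Finset.range n, expNeg (u (q.1 i, q.2 i))) (by fun_prop)).trans ?_
    refine lintegral_congr fun ω => ?_
    refine (lintegral_prod_eq_prod_lintegral_of_indepFun (Finset.range n)
      (fun i ω' => expNeg (u (x i ω, m i ω')))
      (hind.comp (fun i e => expNeg (u (x i ω, e))) (fun i => by fun_prop))
      (fun i => by have := hm i; fun_prop)).trans ?_
    refine Finset.prod_congr rfl fun i _ => ?_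
    rw [← lintegral_map (f := fun e => expNeg (u (x i ω, e))) (by fun_prop) (hm i), hν i]
  have hlim : ∀ v : ℕ → Ω → ℝ≥0∞, (∀ i, Measurable (v i)) →
      Tendsto (fun n => ∫⁻ ω, expNeg (∑ i ∈ Finset.range n, v i ω) ∂P) atTop
        (𝓝 (∫⁻ ω, expNeg (∑' i, v i ω) ∂P)) := fun v hv =>
    tendsto_lintegral_of_dominated_convergence (fun _ => 1)
      (fun n => (Finset.measurable_fun_sum _ fun i _ => hv i).expNeg)
      (fun n => ae_of_all _ fun ω => expNeg_le_one _) (by simp)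
      (ae_of_all _ fun ω => tendsto_expNeg_tsum _)
  have hxi := hx.measurable
  have h1 := hlim (fun i ω => u (x i ω, m i ω)) (fun i => by fun_prop)
  have h2 := hlim (fun i ω => negLog (F (x i ω)))
    (fun i => measurable_negLog.comp (hFm.comp (hxi i)))
  simp_rw [hfin] at h1
  rw [tendsto_nhds_unique h1 h2, hx.lintegral_expNeg_tsum (u := fun z => negLog (F z)) hlam
    (measurable_negLog.comp hFm)]
  simp_rw [fun z => expNeg_negLog (hF1 z)]
  congr 2
  refine lintegral_congr fun z => ?_
  have hmz : Measurable fun e => expNeg (u (z, e)) := by fun_prop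
  rw [lintegral_sub hmz ((hF1 z).trans_lt ENNReal.one_lt_top).ne
    (ae_of_all _ fun e => expNeg_le_one _)]
  simp [hF]

/-! ### The laws of the gains, the exponents and the fading powers -/

instance isProbabilityMeasure_expMeasure_one : IsProbabilityMeasure (expMeasure 1) :=
  isProbabilityMeasure_expMeasure one_pos

lemma lintegral_expMeasure_one {F : ℝ → ℝ≥0∞} (hF : Measurable F) :
    ∫⁻ h, F h ∂(expMeasure 1) = ∫⁻ h in Ioi 0, ENNReal.ofReal (Real.exp (-h)) * F h := by
  have h0 : expMeasure 1 = volume.withDensity (exponentialPDF 1) := rfl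
  have hm : Measurable (exponentialPDF 1) := (measurable_exponentialPDFReal 1).ennreal_ofReal
  rw [h0, lintegral_withDensity_eq_lintegral_mul _ hm hF, setLIntegral_congr Ioi_ae_eq_Ici,
    ← lintegral_indicator measurableSet_Ici]
  refine lintegral_congr fun h => ?_
  by_cases hh : 0 ≤ h
  · rw [indicator_of_mem (mem_Ici.2 hh), Pi.mul_apply, exponentialPDF_of_nonneg hh]
    simp
  · rw [indicator_of_notMem (by simpa using hh), Pi.mul_apply,
      exponentialPDF_of_neg (not_le.1 hh), zero_mul]

lemma ae_pos_expMeasure_one : ∀ᵐ h ∂(expMeasure 1), 0 < h := by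
  rw [ae_iff, ← lintegral_indicator_one (by measurability),
    lintegral_expMeasure_one (measurable_one.indicator (by measurability))]
  refine (setLIntegral_congr_fun measurableSet_Ioi fun h hh => ?_).trans lintegral_zero
  rw [indicator_of_notMem (by simpa using hh), mul_zero]

/-- The tail of the exponential distribution. -/
lemma expMeasure_one_setOf_le (c : ℝ≥0∞) :
    expMeasure 1 {h | c ≤ ENNReal.ofReal h} = expNeg c := by
  rcases eq_or_ne c ⊤ with rfl | hc
  · simp
  obtain ⟨y, rfl⟩ : ∃ y : ℝ≥0, c = y := ⟨c.toNNReal, (ENNReal.coe_toNNReal hc).symm⟩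
  have hm : MeasurableSet {h : ℝ | (y : ℝ≥0∞) ≤ ENNReal.ofReal h} :=
    measurableSet_le measurable_const ENNReal.measurable_ofReal
  have hint := integrableOn_exp_neg_Ioi (y : ℝ)
  rw [← lintegral_indicator_one hm, lintegral_expMeasure_one (measurable_one.indicator hm),
    ← ENNReal.ofReal_coe_nnreal, expNeg_ofReal y.coe_nonneg, ← integral_exp_neg_Ioi,
    ofReal_integral_eq_lintegral_ofReal hint (ae_of_all _ fun h => (Real.exp_pos _).le),
    setLIntegral_congr Ioi_ae_eq_Ici, setLIntegral_congr (Ioi_ae_eq_Ici (a := (y : ℝ))),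
    ← lintegral_indicator measurableSet_Ici, ← lintegral_indicator measurableSet_Ici]
  refine lintegral_congr fun h => ?_
  by_cases h0 : 0 ≤ h
  · by_cases hy : (y : ℝ) ≤ h
    · have : ENNReal.ofReal y ≤ ENNReal.ofReal h := ENNReal.ofReal_le_ofReal hy
      simp [indicator, h0, hy, ENNReal.ofReal_coe_nnreal ▸ this]
    · have : ¬ ENNReal.ofReal y ≤ ENNReal.ofReal h := by
        rwa [ENNReal.ofReal_le_ofReal_iff h0]
      rw [indicator_of_notMem (s := Ici (y : ℝ)) (by simpa using hy),
        indicator_of_mem (mem_Ici.2 h0), indicator_of_notMem, mul_zero]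
      simpa using this
  · rw [indicator_of_notMem (by simpa using h0), indicator_of_notMem]
    intro hy
    exact h0 (le_trans y.2 (mem_Ici.1 hy))

lemma expMeasure_one_setOf_lt (c : ℝ≥0∞) :
    expMeasure 1 {h | ENNReal.ofReal h < c} = 1 - expNeg c := by
  rw [← expMeasure_one_setOf_le, ← prob_compl_eq_one_sub
    (measurableSet_le measurable_const ENNReal.measurable_ofReal)]
  congr 1
  ext h
  simp

lemma lintegral_rpow_expMeasure_one {s : ℝ} (hs : -1 < s) :
    ∫⁻ h, ENNReal.ofReal (h ^ s) ∂(expMeasure 1) = ENNReal.ofReal (Real.Gamma (1 + s)) := by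
  have hs' : 0 < 1 + s := by linarith
  have hint := Real.GammaIntegral_convergent hs'
  rw [lintegral_expMeasure_one (by fun_prop), Real.Gamma_eq_integral hs',
    ofReal_integral_eq_lintegral_ofReal hint]
  · refine setLIntegral_congr_fun measurableSet_Ioi fun h hh => ?_
    simp only [add_sub_cancel_left]
    rw [ENNReal.ofReal_mul (Real.exp_pos _).le]
  · filter_upwards [ae_restrict_mem measurableSet_Ioi] with h hh
    exact mul_nonneg (Real.exp_pos _).le (Real.rpow_nonneg (le_of_lt hh) _)

namespace Params

variable {p : Params}

lemma Admissible.prob_nonneg (hp : p.Admissible) (l : Fin 4) : 0 ≤ p.prob l := by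
  have hpi := Real.two_pi_pos
  have h1 : 0 ≤ p.φt / (2 * Real.pi) := div_nonneg hp.φt_nonneg hpi.le
  have h2 : 0 ≤ p.φr / (2 * Real.pi) := div_nonneg hp.φr_nonneg hpi.le
  have h3 : 0 ≤ 1 - p.φt / (2 * Real.pi) := by
    rw [sub_nonneg, div_le_one hpi]; exact hp.φt_le
  have h4 : 0 ≤ 1 - p.φr / (2 * Real.pi) := by
    rw [sub_nonneg, div_le_one hpi]; exact hp.φr_le
  fin_cases l <;> simp only [prob] <;>
    first | exact mul_nonneg h1 h2 | exact mul_nonneg h1 h4 | exact mul_nonneg h3 h2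
          | exact mul_nonneg h3 h4

lemma sum_prob (p : Params) : ∑ l, p.prob l = 1 := by
  simp only [prob, Fin.sum_univ_four, Matrix.cons_val]
  ring

lemma Admissible.g_pos (hp : p.Admissible) (l : Fin 4) : 0 < p.g l := by
  have := hp.Mt_pos
  have := hp.Mr_pos
  have := hp.mt_pos
  have := hp.mr_pos
  fin_cases l <;> simp [g] <;> positivity

lemma lintegral_gainLaw (p : Params) (F : ℝ → ℝ≥0∞) :
    ∫⁻ G, F G ∂p.gainLaw = ∑ l, ENNReal.ofReal (p.prob l) * F (p.g l) := by
  simp [gainLaw, lintegral_finsetSum_measure]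

lemma Admissible.isProbabilityMeasure_gainLaw (hp : p.Admissible) :
    IsProbabilityMeasure p.gainLaw where
  measure_univ := by
    rw [← lintegral_one, lintegral_gainLaw]
    simp_rw [mul_one]
    rw [← ENNReal.ofReal_sum_of_nonneg fun l _ => hp.prob_nonneg l, sum_prob, ENNReal.ofReal_one]

lemma Admissible.αmin_lt_αmax (hp : p.Admissible) : p.αmin < p.αmax := by
  have := hp.σ_pos
  unfold αmin αmax
  have : 0 < √3 * p.σ := by positivity
  linarith

lemma αmax_sub_αmin (p : Params) : p.αmax - p.αmin = 2 * √3 * p.σ := by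
  unfold αmin αmax; ring

lemma Admissible.isProbabilityMeasure_exponentLaw (hp : p.Admissible) :
    IsProbabilityMeasure p.exponentLaw :=
  cond_isProbabilityMeasure_of_finite
    (by simpa using hp.αmin_lt_αmax) (by simp)

lemma ae_mem_exponentLaw (p : Params) : ∀ᵐ a ∂p.exponentLaw, a ∈ Icc p.αmin p.αmax :=
  ae_cond_mem measurableSet_Icc

lemma Admissible.exponentLaw_eq (hp : p.Admissible) :
    p.exponentLaw =
      ENNReal.ofReal (1 / (2 * √3 * p.σ)) • volume.restrict (Icc p.αmin p.αmax) := by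
  have := hp.σ_pos
  rw [exponentLaw, ProbabilityTheory.cond, Real.volume_Icc, αmax_sub_αmin, one_div,
    ENNReal.ofReal_inv_of_pos (by positivity)]

lemma Admissible.lintegral_exponentLaw (hp : p.Admissible) {f : ℝ → ℝ}
    (hf : ContinuousOn f (Icc p.αmin p.αmax)) (hf0 : ∀ a ∈ Icc p.αmin p.αmax, 0 ≤ f a) :
    ∫⁻ a, ENNReal.ofReal (f a) ∂p.exponentLaw =
      ENNReal.ofReal (1 / (2 * √3 * p.σ) * ∫ a in p.αmin..p.αmax, f a) := by
  have hσ := hp.σ_pos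
  have hint : IntegrableOn f (Icc p.αmin p.αmax) := hf.integrableOn_compact isCompact_Icc
  rw [hp.exponentLaw_eq, lintegral_smul_measure, ENNReal.ofReal_mul (by positivity),
    intervalIntegral.integral_of_le hp.αmin_lt_αmax.le, ← integral_Icc_eq_integral_Ioc,
    ofReal_integral_eq_lintegral_ofReal hint]
  · rfl
  · filter_upwards [ae_restrict_mem measurableSet_Icc] with a ha using hf0 a ha

lemma Admissible.integral_exponentLaw (hp : p.Admissible) (f : ℝ → ℝ) :
    ∫ a, f a ∂p.exponentLaw = ∫ a in p.αmin..p.αmax, 1 / (2 * √3 * p.σ) * f a := by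
  have hσ := hp.σ_pos
  rw [hp.exponentLaw_eq, integral_smul_measure, intervalIntegral.integral_const_mul,
    intervalIntegral.integral_of_le hp.αmin_lt_αmax.le, ← integral_Icc_eq_integral_Ioc,
    ENNReal.toReal_ofReal (by positivity), smul_eq_mul]

/-- The law of everything random that belongs to one station at a given time, apart from its
location. -/
def markLaw (p : Params) (M : ℕ) : Measure ((Fin M → ℝ) × ℝ × ℝ) :=
  (Measure.pi fun _ : Fin M => p.exponentLaw).prod (p.gainLaw.prod (expMeasure 1))

end Params

/-! ### Sections are measurable -/

lemma measurable_azimuth : Measurable azimuth := by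
  unfold azimuth
  simp_rw [toIcoMod_eq_fract_mul]
  exact (measurable_fract.comp (Complex.measurable_arg.div_const _)).mul_const _

lemma measurable_sectionIndex (M : ℕ) [NeZero M] : Measurable (sectionIndex M) := by
  have h : Measurable fun z : ℂ => ⌊azimuth z * M / (2 * Real.pi)⌋₊ :=
    Nat.measurable_floor.comp ((measurable_azimuth.mul_const _).div_const _)
  exact (measurable_of_countable (Fin.ofNat M)).comp h

section

variable {M : ℕ} [NeZero M]

@[fun_prop]
lemma measurable_linkExponent (u : ℂ) :
    Measurable fun q : (Fin M → ℝ) × ℂ => linkExponent q.1 q.2 u := by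
  have h : Measurable fun q : (Fin M → ℝ) × Fin M => q.1 q.2 :=
    measurable_from_prod_countable_left fun j => measurable_pi_apply j
  exact h.comp (measurable_fst.prodMk
    ((measurable_sectionIndex M).comp (measurable_const.sub measurable_snd)))

lemma _root_.Measurable.linkExponent {A : Type*} [MeasurableSpace A] {a : A → Fin M → ℝ}
    {s : A → ℂ} (ha : Measurable a) (hs : Measurable s) (u : ℂ) :
    Measurable fun q => linkExponent (a q) (s q) u :=
  (measurable_linkExponent u).comp (ha.prodMk hs)

lemma _root_.Measurable.pathLoss {A : Type*} [MeasurableSpace A] {a : A → Fin M → ℝ}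
    {s : A → ℂ} (ha : Measurable a) (hs : Measurable s) (u : ℂ) :
    Measurable fun q => pathLoss (a q) (s q) u := by
  unfold SmallCell.pathLoss
  exact (measurable_const.sub hs).norm.pow (ha.linkExponent hs u).neg

end

/-! ### Averaging over the location and the marks of an interferer -/

lemma volume_setOf_lt_mul_rpow {E w a : ℝ} (hE : 0 < E) (hw : 0 < w) (ha : 0 < a) :
    volume {z : ℂ | E < w * ‖z‖ ^ (-a)} = ENNReal.ofReal (Real.pi * (w / E) ^ (2 / a)) := by
  have hset : {z : ℂ | E < w * ‖z‖ ^ (-a)} = Metric.ball 0 ((w / E) ^ a⁻¹) \ {0} := by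
    ext z
    simp only [mem_ofPred_eq, Set.mem_sdiff, mem_ball_zero_iff, mem_singleton_iff]
    rcases eq_or_ne z 0 with rfl | hz
    · simp [Real.zero_rpow (neg_ne_zero.2 ha.ne'), hE.le]
    · have hz' : 0 < ‖z‖ := norm_pos_iff.2 hz
      rw [Real.lt_rpow_inv_iff_of_pos hz'.le (by positivity) ha, Real.rpow_neg hz'.le,
        ← div_eq_mul_inv, lt_div_iff₀ (by positivity), lt_div_iff₀ hE, mul_comm]
      simp [hz]
  rw [hset, measure_sdiff_null (by simp), Complex.volume_ball, ← ENNReal.ofReal_pow (by positivity),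
    ← ENNReal.ofReal_coe_nnreal, NNReal.coe_real_pi, ← ENNReal.ofReal_mul (by positivity),
    ← Real.rpow_natCast, ← Real.rpow_mul (by positivity), mul_comm]
  congr 3
  field_simp
  simp

variable {p : Params}

/-- The average of a function of the link exponent, the distance and the gains of an interferer
over its location and marks does not depend on the number of sections: seen from a fixed location,
the exponent of the link is uniform, and Lebesgue measure is invariant under translations. -/
lemma lintegral_lintegral_prod_pi (hp : p.Admissible) {M : ℕ} [NeZero M] {Q : Type*}
    [MeasurableSpace Q] (ρ : Measure Q) [SFinite ρ] {F : ℝ × ℝ × Q → ℝ≥0∞} (hF : Measurable F)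
    (u : ℂ) :
    ∫⁻ z, ∫⁻ m, F (linkExponent m.1 z u, ‖u - z‖, m.2)
        ∂((Measure.pi fun _ : Fin M => p.exponentLaw).prod ρ) =
      ∫⁻ q, ∫⁻ a, (∫⁻ z : ℂ, F (a, ‖z‖, q)) ∂p.exponentLaw ∂ρ := by
  have := hp.isProbabilityMeasure_exponentLaw
  calc ∫⁻ z, ∫⁻ m, F (linkExponent m.1 z u, ‖u - z‖, m.2)
        ∂((Measure.pi fun _ : Fin M => p.exponentLaw).prod ρ)
      = ∫⁻ z : ℂ, ∫⁻ a, ∫⁻ q, F (a, ‖u - z‖, q) ∂ρ ∂p.exponentLaw := by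
        refine lintegral_congr fun z => ?_
        have h1 : Measurable fun m : (Fin M → ℝ) × Q =>
            F (linkExponent m.1 z u, ‖u - z‖, m.2) :=
          hF.comp ((measurable_fst.linkExponent measurable_const u).prodMk
            (measurable_const.prodMk measurable_snd))
        rw [lintegral_prod _ h1.aemeasurable]
        exact (measurePreserving_eval (fun _ : Fin M => p.exponentLaw)
          (sectionIndex M (u - z))).lintegral_comp (f := fun a => ∫⁻ q, F (a, ‖u - z‖, q) ∂ρ)
            (Measurable.lintegral_prod_right' (f := fun q : ℝ × Q => F (q.1, ‖u - z‖, q.2))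
              (by fun_prop))
    _ = ∫⁻ z : ℂ, ∫⁻ a, ∫⁻ q, F (a, ‖z‖, q) ∂ρ ∂p.exponentLaw :=
        lintegral_sub_left_eq_self (μ := volume)
          (fun z : ℂ => ∫⁻ a, ∫⁻ q, F (a, ‖z‖, q) ∂ρ ∂p.exponentLaw) u
    _ = ∫⁻ z : ℂ, ∫⁻ q, ∫⁻ a, F (a, ‖z‖, q) ∂p.exponentLaw ∂ρ := by
        refine lintegral_congr fun z => ?_
        exact lintegral_lintegral_swap (Measurable.aemeasurable (by fun_prop))
    _ = ∫⁻ q, (∫⁻ z : ℂ, ∫⁻ a, F (a, ‖z‖, q) ∂p.exponentLaw) ∂ρ := by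
        refine lintegral_lintegral_swap (Measurable.aemeasurable ?_)
        exact Measurable.lintegral_prod_right'
          (f := fun q : (ℂ × Q) × ℝ => F (q.2, ‖q.1.1‖, q.1.2)) (by fun_prop)
    _ = _ := by
        refine lintegral_congr fun q => ?_
        exact lintegral_lintegral_swap (Measurable.aemeasurable (by fun_prop))

lemma Params.Admissible.two_div_mem_Ioo (hp : p.Admissible) {a : ℝ}
    (ha : a ∈ Icc p.αmin p.αmax) : 2 / a ∈ Ioo (0 : ℝ) 1 := by
  have h2 : 2 < a := hp.two_lt_αmin.trans_le ha.1
  exact ⟨by positivity, (div_lt_one (by linarith)).2 h2⟩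

lemma Params.Admissible.continuousOn_two_div (hp : p.Admissible) :
    ContinuousOn (fun a : ℝ => 2 / a) (Icc p.αmin p.αmax) := by
  refine continuousOn_const.div continuousOn_id fun a ha => ?_
  have h2 : 2 < a := hp.two_lt_αmin.trans_le ha.1
  exact (by linarith : (0 : ℝ) < a).ne'

/-- If the gain `G` and the fading power `h` enter the average over the plane through
`K a G * h ^ (2 / a)`, averaging over the fading produces the factor `Γ (1 + 2 / a)`. -/
lemma lintegral_markLaw (hp : p.Admissible) {M : ℕ} [NeZero M] {F : ℝ × ℝ × ℝ × ℝ → ℝ≥0∞}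
    (hF : Measurable F) {K : ℝ → ℝ → ℝ} 
    (hK : ∀ l, ContinuousOn (fun a => K a (p.g l)) (Icc p.αmin p.αmax))
    (hK0 : ∀ a ∈ Icc p.αmin p.αmax, ∀ l, 0 ≤ K a (p.g l))
    (hFK : ∀ a ∈ Icc p.αmin p.αmax, ∀ l, ∀ h, 0 < h →
      ∫⁻ z : ℂ, F (a, ‖z‖, p.g l, h) = ENNReal.ofReal (K a (p.g l) * h ^ (2 / a)))
    (u : ℂ) :
    ∫⁻ z, ∫⁻ m, F (linkExponent m.1 z u, ‖u - z‖, m.2) ∂(p.markLaw M) =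
      ∑ l, ENNReal.ofReal (p.prob l) *
        ∫⁻ a, ENNReal.ofReal (K a (p.g l) * Real.Gamma (1 + 2 / a)) ∂p.exponentLaw := by
  have := hp.isProbabilityMeasure_exponentLaw
  have := hp.isProbabilityMeasure_gainLaw
  have hmeas : Measurable fun q : ℝ × ℝ => ∫⁻ a, (∫⁻ z : ℂ, F (a, ‖z‖, q)) ∂p.exponentLaw :=
    Measurable.lintegral_prod_right' (f := fun r : (ℝ × ℝ) × ℝ => ∫⁻ z : ℂ, F (r.2, ‖z‖, r.1))
      (Measurable.lintegral_prod_right'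
        (f := fun r : ((ℝ × ℝ) × ℝ) × ℂ => F (r.1.2, ‖r.2‖, r.1.1)) (by fun_prop))
  rw [Params.markLaw, lintegral_lintegral_prod_pi hp _ hF, lintegral_prod _ hmeas.aemeasurable,
    Params.lintegral_gainLaw]
  refine Finset.sum_congr rfl fun l _ => ?_
  congr 1
  calc ∫⁻ h, ∫⁻ a, (∫⁻ z : ℂ, F (a, ‖z‖, p.g l, h)) ∂p.exponentLaw ∂(expMeasure 1)
      = ∫⁻ h, ∫⁻ a, ENNReal.ofReal (K a (p.g l) * h ^ (2 / a)) ∂p.exponentLaw ∂(expMeasure 1) := by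
        refine lintegral_congr_ae ?_
        filter_upwards [ae_pos_expMeasure_one] with h hh
        refine lintegral_congr_ae ?_
        filter_upwards [p.ae_mem_exponentLaw] with a ha using hFK a ha l h hh
    _ = ∫⁻ a, ∫⁻ h, ENNReal.ofReal (K a (p.g l) * h ^ (2 / a)) ∂(expMeasure 1) ∂p.exponentLaw := by
        have hKm : AEMeasurable (fun a => K a (p.g l)) p.exponentLaw := by
          rw [hp.exponentLaw_eq]
          exact ((hK l).aemeasurable measurableSet_Icc).smul_measure _
        exact lintegral_lintegral_swap
          (hKm.comp_snd.mul (Measurable.aemeasurable (by fun_prop))).ennreal_ofReal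
    _ = _ := by
        refine lintegral_congr_ae ?_
        filter_upwards [p.ae_mem_exponentLaw] with a ha
        simp_rw [ENNReal.ofReal_mul (hK0 a ha l)]
        rw [lintegral_const_mul _ (by fun_prop), lintegral_rpow_expMeasure_one]
        exact lt_trans (by norm_num) (hp.two_div_mem_Ioo ha).1

/-! ### Functionals of the powers received from the interferers -/

lemma continuousOn_Gamma_comp {f : ℝ → ℝ} {s : Set ℝ} (hf : ContinuousOn f s)
    (hpos : ∀ a ∈ s, 0 < f a) : ContinuousOn (fun a => Real.Gamma (f a)) s :=
  Real.differentiableOn_Gamma_Ioi.continuousOn.comp hf hpos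

lemma continuousOn_const_rpow_comp {c : ℝ} (hc : 0 < c) {f : ℝ → ℝ} {s : Set ℝ}
    (hf : ContinuousOn f s) : ContinuousOn (fun a => c ^ f a) s :=
  continuousOn_const.rpow hf fun _ _ => Or.inl hc.ne'

lemma measurableSet_setOf_forall_le {A : Type*} [MeasurableSpace A] {f : A → ℕ → ℝ} {g : A → ℝ}
    (hf : Measurable f) (hg : Measurable g) : MeasurableSet {q | ∀ i, f q i ≤ g q} := by
  have : {q | ∀ i, f q i ≤ g q} = ⋂ i, {q | f q i ≤ g q} := by ext; simp
  rw [this]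
  exact MeasurableSet.iInter fun i => measurableSet_le (hf.eval (a := i)) hg

namespace Network

lemma IsModel.map_mark {M : ℕ} {Ω : Type*} [MeasurableSpace Ω] {N : Network M Ω}
    {P : Measure Ω} (hN : N.IsModel p P) (k : Fin 2) (i : Option ℕ) :
    P.map (N.mark k i) = p.markLaw M := hN.mark_law k i

variable {M : ℕ} [NeZero M] {Ω : Type*} [MeasurableSpace Ω] {N : Network M Ω}
  {P : Measure Ω}

lemma IsModel.measurable_otherPower (hN : N.IsModel p P) (k : Fin 2) (u : ℂ) (i : ℕ) :
    Measurable (N.otherPower p k u i) := by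
  have hm := hN.measurable_mark k (some i)
  exact ((hm.snd.fst.const_mul p.PT).mul hm.snd.snd).mul
    (hm.fst.pathLoss (hN.poisson.measurable i) u)

variable [IsProbabilityMeasure P]

/-- The Laplace functional of the powers received from the interferers, for a function `Ψ` of the
power whose average over the plane is proportional to `h ^ (2 / a)`. -/
theorem IsModel.lintegral_expNeg_tsum_otherPower (hp : p.Admissible) (hN : N.IsModel p P)
    (k : Fin 2) (u : ℂ) {Ψ : ℝ → ℝ≥0∞} (hΨ : Measurable Ψ) {K : ℝ → ℝ → ℝ}
    (hK : ∀ l, ContinuousOn (fun a => K a (p.g l)) (Icc p.αmin p.αmax))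
    (hK0 : ∀ a ∈ Icc p.αmin p.αmax, ∀ l, 0 ≤ K a (p.g l))
    (hΨK : ∀ a ∈ Icc p.αmin p.αmax, ∀ l, ∀ h, 0 < h →
      ∫⁻ z : ℂ, (1 - expNeg (Ψ (p.PT * p.g l * h * ‖z‖ ^ (-a)))) =
        ENNReal.ofReal (K a (p.g l) * h ^ (2 / a))) :
    ∫⁻ ω, expNeg (∑' i, Ψ (N.otherPower p k u i ω)) ∂P =
      ENNReal.ofReal (Real.exp (-(p.lam / (2 * √3 * p.σ) * ∑ l, p.prob l *
        ∫ a in p.αmin..p.αmax, K a (p.g l) * Real.Gamma (1 + 2 / a)))) := by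
  have hσ := hp.σ_pos
  have hlam := hp.lam_pos
  have hm := fun i : ℕ => hN.measurable_mark k (some i)
  have hu : Measurable fun q : ℂ × (Fin M → ℝ) × ℝ × ℝ =>
      Ψ (p.PT * q.2.2.1 * q.2.2.2 * pathLoss q.2.1 q.1 u) := by
    have : Measurable fun q : ℂ × (Fin M → ℝ) × ℝ × ℝ => pathLoss q.2.1 q.1 u :=
      measurable_snd.fst.pathLoss measurable_fst u
    fun_prop
  have h1 := hN.poisson.lintegral_expNeg_tsum_marked hlam.le hm (fun i => hN.map_mark k (some i))
    ((hN.mark_indep k).precomp (Option.some_injective ℕ))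
    ((hN.location_indep k).comp measurable_id
      (measurable_pi_lambda (fun (f : Option ℕ → (Fin M → ℝ) × ℝ × ℝ) (i : ℕ) => f (some i))
        fun i => measurable_pi_apply (some i))) hu
  have h2 := lintegral_markLaw hp (M := M)
    (F := fun q => 1 - expNeg (Ψ (p.PT * q.2.2.1 * q.2.2.2 * q.2.1 ^ (-q.1))))
    (by fun_prop) hK hK0 hΨK u
  have hGamma : ContinuousOn (fun a : ℝ => Real.Gamma (1 + 2 / a)) (Icc p.αmin p.αmax) :=
    continuousOn_Gamma_comp (continuousOn_const.add hp.continuousOn_two_div) fun a ha => by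
      have := (hp.two_div_mem_Ioo ha).1; linarith
  have h3 : ∀ l, ∀ a ∈ Icc p.αmin p.αmax, 0 ≤ K a (p.g l) * Real.Gamma (1 + 2 / a) :=
    fun l a ha => mul_nonneg (hK0 a ha l) (Real.Gamma_nonneg_of_nonneg (by
      have := (hp.two_div_mem_Ioo ha).1; linarith))
  have h4 : ∀ l, 0 ≤ ∫ a in p.αmin..p.αmax, K a (p.g l) * Real.Gamma (1 + 2 / a) := fun l =>
    intervalIntegral.integral_nonneg hp.αmin_lt_αmax.le (h3 l)
  have h5 := hp.prob_nonneg
  refine h1.trans ((congrArg (fun t => expNeg (ENNReal.ofReal p.lam * t)) h2).trans ?_)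
  rw [← expNeg_ofReal (mul_nonneg (by positivity)
    (Finset.sum_nonneg fun l _ => mul_nonneg (h5 l) (h4 l)))]
  have h6 : ∀ l, ∫⁻ a, ENNReal.ofReal (K a (p.g l) * Real.Gamma (1 + 2 / a)) ∂p.exponentLaw =
      ENNReal.ofReal (1 / (2 * √3 * p.σ) *
        ∫ a in p.αmin..p.αmax, K a (p.g l) * Real.Gamma (1 + 2 / a)) :=
    fun l => hp.lintegral_exponentLaw ((hK l).mul hGamma) (h3 l)
  simp_rw [h6, ← ENNReal.ofReal_mul (h5 _)]
  rw [← ENNReal.ofReal_sum_of_nonneg fun l _ => mul_nonneg (h5 l)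
    (mul_nonneg (by positivity) (h4 l)), ← ENNReal.ofReal_mul hlam.le, Finset.mul_sum,
    Finset.mul_sum]
  congr 2
  refine Finset.sum_congr rfl fun l _ => ?_
  ring

lemma lintegral_one_sub_expNeg_rpow {w a : ℝ} (hw : 0 < w) (ha : 2 < a) :
    ∫⁻ z : ℂ, (1 - expNeg (ENNReal.ofReal (w * ‖z‖ ^ (-a)))) =
      ENNReal.ofReal (Real.pi * w ^ (2 / a) * Real.Gamma (1 - 2 / a)) := by
  have ha0 : 0 < a := by linarith
  have h2 : 2 / a < 1 := (div_lt_one ha0).2 ha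
  -- `1 - exp (-c)` is the probability that an exponential variable is less than `c`
  calc ∫⁻ z : ℂ, (1 - expNeg (ENNReal.ofReal (w * ‖z‖ ^ (-a))))
      = ∫⁻ z : ℂ, ∫⁻ E, {q : ℂ × ℝ |
          ENNReal.ofReal q.2 < ENNReal.ofReal (w * ‖q.1‖ ^ (-a))}.indicator 1 (z, E)
          ∂(expMeasure 1) := by
        refine lintegral_congr fun z => ?_
        rw [← expMeasure_one_setOf_lt, ← lintegral_indicator_one
          (measurableSet_lt ENNReal.measurable_ofReal measurable_const)]
        rfl
    _ = ∫⁻ E, (∫⁻ z : ℂ, {q : ℂ × ℝ |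
          ENNReal.ofReal q.2 < ENNReal.ofReal (w * ‖q.1‖ ^ (-a))}.indicator 1 (z, E))
          ∂(expMeasure 1) := by
        refine lintegral_lintegral_swap (Measurable.aemeasurable ?_)
        exact measurable_one.indicator (measurableSet_lt (by fun_prop) (by fun_prop))
    _ = ∫⁻ E, ENNReal.ofReal (Real.pi * w ^ (2 / a)) * ENNReal.ofReal (E ^ (-(2 / a)))
          ∂(expMeasure 1) := by
        refine lintegral_congr_ae ?_
        filter_upwards [ae_pos_expMeasure_one] with E hE
        rw [← ENNReal.ofReal_mul (by positivity), mul_assoc, Real.rpow_neg hE.le,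
          ← div_eq_mul_inv, ← Real.div_rpow hw.le hE.le, ← volume_setOf_lt_mul_rpow hE hw ha0,
          ← lintegral_indicator_one (measurableSet_lt measurable_const (by fun_prop))]
        refine lintegral_congr fun z => ?_
        have : ENNReal.ofReal E < ENNReal.ofReal (w * ‖z‖ ^ (-a)) ↔ E < w * ‖z‖ ^ (-a) :=
          ENNReal.ofReal_lt_ofReal_iff_of_nonneg hE.le
        simp [indicator, this]
    _ = _ := by
        rw [lintegral_const_mul _ (by fun_prop), lintegral_rpow_expMeasure_one (by linarith),
          ← ENNReal.ofReal_mul (by positivity)]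
        rfl

/-- The Laplace transform of the interference. -/
theorem IsModel.lintegral_expNeg_interference (hp : p.Admissible) (hN : N.IsModel p P)
    (k : Fin 2) (u : ℂ) {s : ℝ} (hs : 0 < s) :
    ∫⁻ ω, expNeg (ENNReal.ofReal s * N.interference p k u ω) ∂P =
      ENNReal.ofReal (Real.exp (-(p.lam * Real.pi ^ 2 / (√3 * p.σ) * ∑ l, p.prob l *
        ∫ α in p.αmin..p.αmax,
          (s * p.PT * p.g l) ^ (2 / α) * (Real.sin (2 * Real.pi / α))⁻¹ / α))) := by
  have hPT := hp.PT_pos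
  have hg := hp.g_pos
  have hw : ∀ l, 0 < s * p.PT * p.g l := fun l => mul_pos (mul_pos hs hPT) (hg l)
  have h := hN.lintegral_expNeg_tsum_otherPower hp k u
    (Ψ := fun y => ENNReal.ofReal (s * y)) (by fun_prop)
    (K := fun a G => Real.pi * (s * p.PT * G) ^ (2 / a) * Real.Gamma (1 - 2 / a))
    (fun l => (continuousOn_const.mul (continuousOn_const_rpow_comp (hw l)
      hp.continuousOn_two_div)).mul (continuousOn_Gamma_comp
        (continuousOn_const.sub hp.continuousOn_two_div) fun a ha => by
          have := (hp.two_div_mem_Ioo ha).2; linarith))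
    (fun a ha l => mul_nonneg (mul_nonneg Real.pi_pos.le (Real.rpow_nonneg (hw l).le _))
      (Real.Gamma_nonneg_of_nonneg (by have := (hp.two_div_mem_Ioo ha).2; linarith)))
    (fun a ha l h hh => by
      have h2 := lintegral_one_sub_expNeg_rpow (mul_pos (hw l) hh) (hp.two_lt_αmin.trans_le ha.1)
      rw [Real.mul_rpow (hw l).le hh.le] at h2
      rw [show Real.pi * (s * p.PT * p.g l) ^ (2 / a) * Real.Gamma (1 - 2 / a) * h ^ (2 / a) =
        Real.pi * ((s * p.PT * p.g l) ^ (2 / a) * h ^ (2 / a)) * Real.Gamma (1 - 2 / a) by ring,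
        ← h2]
      simp_rw [mul_assoc])
  have h1 : ∀ ω, ENNReal.ofReal s * N.interference p k u ω =
      ∑' i, ENNReal.ofReal (s * N.otherPower p k u i ω) := fun ω => by
    simp_rw [interference, ← ENNReal.tsum_mul_left, ENNReal.ofReal_mul hs.le]
  simp_rw [h1, h]
  congr 3
  -- the reflection formula for `Γ`
  have hint : ∀ l, ∫ a in p.αmin..p.αmax, Real.pi * (s * p.PT * p.g l) ^ (2 / a) *
        Real.Gamma (1 - 2 / a) * Real.Gamma (1 + 2 / a) =
      2 * Real.pi ^ 2 * ∫ α in p.αmin..p.αmax,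
          (s * p.PT * p.g l) ^ (2 / α) * (Real.sin (2 * Real.pi / α))⁻¹ / α := by
    intro l
    rw [← intervalIntegral.integral_const_mul]
    refine intervalIntegral.integral_congr fun a ha => ?_
    rw [uIcc_of_le hp.αmin_lt_αmax.le] at ha
    have h2 := (hp.two_div_mem_Ioo ha).1
    have h3 : Real.Gamma (1 - 2 / a) * Real.Gamma (1 + 2 / a) =
        2 / a * (Real.pi / Real.sin (2 * Real.pi / a)) := by
      rw [add_comm, Real.Gamma_add_one h2.ne', show 2 * Real.pi / a = Real.pi * (2 / a) by ring,
        ← Real.Gamma_mul_Gamma_one_sub]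
      ring
    rw [mul_assoc, h3]
    ring
  simp_rw [hint]
  rw [Finset.mul_sum, Finset.mul_sum]
  refine Finset.sum_congr rfl fun l _ => ?_
  have := hp.σ_pos
  field_simp

/-- The probability that no interferer is received with more power than `T`. -/
theorem IsModel.measure_forall_otherPower_le (hp : p.Admissible) (hN : N.IsModel p P)
    (k : Fin 2) (u : ℂ) {T : ℝ} (hT : 0 < T) :
    P {ω | ∀ i, N.otherPower p k u i ω ≤ T} =
      ENNReal.ofReal (Real.exp (-(p.lam * Real.pi / (√3 * p.σ) * ∑ l, p.prob l *
        ∫ α in p.αmin..p.αmax,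
          (T / (p.PT * p.g l)) ^ (-2 / α) * Real.Gamma (2 / α) / α))) := by
  have hPT := hp.PT_pos
  have hg := hp.g_pos
  have hw : ∀ l, 0 < p.PT * p.g l / T := fun l => div_pos (mul_pos hPT (hg l)) hT
  have h := hN.lintegral_expNeg_tsum_otherPower hp k u
    -- with this choice `exp (-∑ Ψ)` is the indicator of the event
    (Ψ := (Ioi T).indicator fun _ => ⊤) (measurable_const.indicator measurableSet_Ioi)
    (K := fun a G => Real.pi * (p.PT * G / T) ^ (2 / a))
    (fun l => continuousOn_const.mul (continuousOn_const_rpow_comp (hw l) hp.continuousOn_two_div))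
    (fun a ha l => mul_nonneg Real.pi_pos.le (Real.rpow_nonneg (hw l).le _))
    (fun a ha l h hh => by
      have h2 := hp.two_lt_αmin.trans_le ha.1
      rw [mul_assoc Real.pi, ← Real.mul_rpow (hw l).le hh.le, show p.PT * p.g l / T * h =
        p.PT * p.g l * h / T by ring, ← volume_setOf_lt_mul_rpow hT
        (mul_pos (mul_pos hPT (hg l)) hh) (by linarith), ← lintegral_indicator_one
          (measurableSet_lt measurable_const (by fun_prop))]
      refine lintegral_congr fun z => ?_
      by_cases hz : T < p.PT * p.g l * h * ‖z‖ ^ (-a) <;> simp [indicator, hz])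
  have hmeas : MeasurableSet {ω | ∀ i, N.otherPower p k u i ω ≤ T} :=
    measurableSet_setOf_forall_le (measurable_pi_lambda _ (hN.measurable_otherPower k u))
      measurable_const
  have h1 : ∀ ω, {ω | ∀ i, N.otherPower p k u i ω ≤ T}.indicator 1 ω =
      expNeg (∑' i, (Ioi T).indicator (fun _ => ⊤) (N.otherPower p k u i ω)) := by
    intro ω
    by_cases hω : ∀ i, N.otherPower p k u i ω ≤ T
    · have : ∀ i, (Ioi T).indicator (fun _ => (⊤ : ℝ≥0∞)) (N.otherPower p k u i ω) = 0 :=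
        fun i => indicator_of_notMem (by simpa using hω i) _
      rw [indicator_of_mem (by exact hω)]
      simp [this]
    · rw [indicator_of_notMem (by exact hω)]
      push Not at hω
      obtain ⟨i, hi⟩ := hω
      rw [ENNReal.tsum_eq_top_of_eq_top ⟨i, indicator_of_mem hi _⟩, expNeg_top]
  rw [← lintegral_indicator_one hmeas]
  simp_rw [h1, h]
  congr 3
  have hint : ∀ l, ∫ a in p.αmin..p.αmax, Real.pi * (p.PT * p.g l / T) ^ (2 / a) *
        Real.Gamma (1 + 2 / a) =
      2 * Real.pi * ∫ α in p.αmin..p.αmax,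
          (T / (p.PT * p.g l)) ^ (-2 / α) * Real.Gamma (2 / α) / α := by
    intro l
    rw [← intervalIntegral.integral_const_mul]
    refine intervalIntegral.integral_congr fun a ha => ?_
    rw [uIcc_of_le hp.αmin_lt_αmax.le] at ha
    have h2 := (hp.two_div_mem_Ioo ha).1
    rw [add_comm, Real.Gamma_add_one h2.ne', neg_div, Real.rpow_neg
      (div_nonneg hT.le (mul_pos hPT (hg l)).le), ← Real.inv_rpow
      (div_nonneg hT.le (mul_pos hPT (hg l)).le), inv_div]
    ring
  simp_rw [hint]
  rw [Finset.mul_sum, Finset.mul_sum]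
  refine Finset.sum_congr rfl fun l _ => ?_
  have := hp.σ_pos
  field_simp

end Network

/-! ### Independence of the serving link and the interferers -/

/-- A member of an independent family is independent of the rest of the family, here indexed by a
disjoint set of indices. -/
lemma indepFun_apply_of_iIndepFun {Ω ι κ A : Type*} [MeasurableSpace Ω] [MeasurableSpace A]
    {P : Measure Ω} {f : ι → Ω → A} (hf : ∀ i, Measurable (f i)) (h : iIndepFun f P) (i : ι)
    {e : κ → ι} (he : ∀ k, e k ≠ i) : IndepFun (f i) (fun ω k => f (e k) ω) P := by
  have h1 := indep_iSup_of_disjoint (S := {i}) (T := {i}ᶜ) (fun j => (hf j).comap_le) h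
    disjoint_compl_right
  refine (IndepFun_iff_Indep _ _ _).2 (indep_of_indep_of_le_right (indep_of_indep_of_le_left h1
    ?_) ?_)
  · exact le_iSup₂_of_le i rfl le_rfl
  · simp_rw [MeasurableSpace.pi, MeasurableSpace.comap_iSup, MeasurableSpace.comap_comp]
    refine iSup_le fun k => ?_
    exact le_iSup₂_of_le (f := fun j (_ : j ∈ ({i}ᶜ : Set ι)) =>
      MeasurableSpace.comap (f j) inferInstance) (e k) (he k) le_rfl

namespace Network

variable {M : ℕ} {Ω : Type*} [MeasurableSpace Ω] {N : Network M Ω}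
  {P : Measure Ω}

lemma IsModel.measurable_α (hN : N.IsModel p P) (i : Option ℕ) : Measurable (N.α i) :=
  (hN.measurable_mark 0 i).fst

lemma IsModel.measurable_gain_fading (hN : N.IsModel p P) (k : Fin 2) (i : Option ℕ) :
    Measurable fun ω => (N.G k i ω, N.h k i ω) := (hN.measurable_mark k i).snd

lemma IsModel.measurable_fading (hN : N.IsModel p P) (k : Fin 2) (i : Option ℕ) :
    Measurable (N.h k i) := (hN.measurable_mark k i).snd.snd

lemma IsModel.map_gain_fading (hp : p.Admissible) (hN : N.IsModel p P) (k : Fin 2)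
    (i : Option ℕ) :
    P.map (fun ω => (N.G k i ω, N.h k i ω)) = p.gainLaw.prod (expMeasure 1) := by
  have := hp.isProbabilityMeasure_exponentLaw
  have := hp.isProbabilityMeasure_gainLaw
  have h := congrArg (Measure.map Prod.snd) (hN.mark_law k i)
  rw [Measure.map_map measurable_snd (hN.measurable_mark k i), Measure.map_snd_prod,
    measure_univ, one_smul] at h
  exact h

lemma IsModel.map_fading (hp : p.Admissible) (hN : N.IsModel p P) (k : Fin 2)
    (i : Option ℕ) : P.map (N.h k i) = expMeasure 1 := by
  have := hp.isProbabilityMeasure_gainLaw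
  have h := congrArg (Measure.map Prod.snd) (hN.map_gain_fading hp k i)
  rw [Measure.map_map measurable_snd (hN.measurable_gain_fading k i), Measure.map_snd_prod,
    measure_univ, one_smul] at h
  exact h

lemma IsModel.map_exponent (hp : p.Admissible) (hN : N.IsModel p P)
    (i : Option ℕ) (j : Fin M) : P.map (fun ω => N.α i ω j) = p.exponentLaw := by
  have := hp.isProbabilityMeasure_exponentLaw
  have := hp.isProbabilityMeasure_gainLaw
  have h := congrArg (Measure.map fun m => m.1 j) (hN.mark_law 0 i)
  have h' : Measure.map (fun m : (Fin M → ℝ) × ℝ × ℝ => m.1 j)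
      ((Measure.pi fun _ : Fin M => p.exponentLaw).prod (p.gainLaw.prod (expMeasure 1))) =
        p.exponentLaw :=
    ((measurePreserving_eval (fun _ : Fin M => p.exponentLaw) j).comp
      measurePreserving_fst).map_eq
  rw [h', Measure.map_map (by fun_prop) (hN.measurable_mark 0 i)] at h
  exact h

variable [NeZero M]

lemma IsModel.measurable_servingExponent (hN : N.IsModel p P) (Θ r : ℝ) :
    Measurable (N.servingExponent Θ r) :=
  (hN.measurable_α none).eval (a := sectionIndex M (0 - servingLocation Θ r))

variable [IsProbabilityMeasure P]

lemma IsModel.indepFun_mark_none_otherPower (hN : N.IsModel p P) (k : Fin 2) (u : ℂ) :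
    IndepFun (N.mark k none) (fun ω i => N.otherPower p k u i ω) P := by
  have hm := hN.measurable_mark k
  have hx : Measurable fun ω i => N.x i ω := measurable_pi_lambda _ hN.poisson.measurable
  have hs : Measurable fun ω (i : ℕ) => N.mark k (some i) ω :=
    measurable_pi_lambda _ fun i => hm (some i)
  have h1 : IndepFun (N.mark k none) (fun ω (i : ℕ) => N.mark k (some i) ω) P :=
    indepFun_apply_of_iIndepFun hm (hN.mark_indep k) none fun i => by simp
  have h2 : IndepFun (fun ω i => N.x i ω)
      (fun ω => (N.mark k none ω, fun i : ℕ => N.mark k (some i) ω)) P :=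
    (hN.location_indep k).comp measurable_id
      (ψ := fun f : Option ℕ → (Fin M → ℝ) × ℝ × ℝ => (f none, fun i : ℕ => f (some i)))
      (by fun_prop)
  have h3 := indepFun_prodMk_of_indepFun hx (hm none) hs h2 h1
  refine h3.comp measurable_id (ψ := fun q : (ℕ → ℂ) × (ℕ → (Fin M → ℝ) × ℝ × ℝ) => fun i =>
    p.PT * (q.2 i).2.1 * (q.2 i).2.2 * pathLoss (q.2 i).1 (q.1 i) u) ?_
  refine measurable_pi_lambda _ fun i => ?_
  have : Measurable fun q : (ℕ → ℂ) × (ℕ → (Fin M → ℝ) × ℝ × ℝ) =>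
      pathLoss (q.2 i).1 (q.1 i) u :=
    Measurable.pathLoss (by fun_prop) (by fun_prop) u
  fun_prop

lemma IsModel.indepFun_otherPower_gain_fading (hN : N.IsModel p P) (k : Fin 2) (u : ℂ) :
    IndepFun (fun ω i => N.otherPower p k u i ω) (fun ω => (N.G k none ω, N.h k none ω)) P :=
  ((hN.indepFun_mark_none_otherPower k u).comp measurable_snd measurable_id).symm

/-- The exponent of a section of the serving station is independent of the gain and the fading
power of its link together with the powers received from the interferers. -/
lemma IsModel.indepFun_exponent (hp : p.Admissible) (hN : N.IsModel p P) (k : Fin 2) (u : ℂ)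
    (j : Fin M) :
    IndepFun (fun ω => N.α none ω j)
      (fun ω => ((fun i => N.otherPower p k u i ω), (N.G k none ω, N.h k none ω))) P := by
  have := hp.isProbabilityMeasure_exponentLaw
  have := hp.isProbabilityMeasure_gainLaw
  have hm := hN.measurable_mark k none
  have hα := hN.measurable_α none
  have hGh := hN.measurable_gain_fading k none
  have h1 : IndepFun (N.α none) (fun ω => (N.G k none ω, N.h k none ω)) P := by
    rw [indepFun_iff_map_prod_eq_prod_map_map hα.aemeasurable hGh.aemeasurable,
      hN.map_gain_fading hp]
    have h := congrArg (Measure.map Prod.fst) (hN.mark_law k none)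
    rw [Measure.map_map measurable_fst hm, Measure.map_fst_prod, measure_univ, one_smul] at h
    have h' : P.map (N.α none) = Measure.pi fun _ : Fin M => p.exponentLaw := h
    rw [h']
    exact hN.mark_law k none
  have h2 := (hN.indepFun_mark_none_otherPower k u).comp
    (φ := fun m => (m.1 j, m.2)) (by fun_prop) measurable_id
  exact indepFun_prodMk_of_indepFun (measurable_pi_lambda _ (hN.measurable_otherPower k u))
    (hα.eval (a := j)) hGh h2.symm (h1.comp (measurable_pi_apply j) measurable_id)

/-! ### The conditional outage probability -/

lemma newLocation_sub_servingLocation (Θ d r : ℝ) :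
    newLocation Θ d - servingLocation Θ r = (r + d : ℝ) * Complex.exp (Θ * Complex.I) := by
  simp only [newLocation, servingLocation]
  push_cast
  ring

/-- Moving directly away from the serving station, the user stays in the same section. -/
lemma sectionIndex_newLocation_sub {r d : ℝ} (hr : 0 < r) (hd : 0 ≤ d) (Θ : ℝ) :
    sectionIndex M (newLocation Θ d - servingLocation Θ r) =
      sectionIndex M (0 - servingLocation Θ r) := by
  have h0 : 0 - servingLocation Θ r = (r : ℝ) * Complex.exp (Θ * Complex.I) := by
    simp [servingLocation]
  have h1 : azimuth (newLocation Θ d - servingLocation Θ r) =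
      azimuth (0 - servingLocation Θ r) := by
    rw [newLocation_sub_servingLocation, h0, azimuth, azimuth,
      Complex.arg_real_mul _ (by linarith), Complex.arg_real_mul _ hr]
  rw [sectionIndex, sectionIndex, h1]

lemma norm_newLocation_sub {r d : ℝ} (hr : 0 < r) (hd : 0 ≤ d) (Θ : ℝ) :
    ‖newLocation Θ d - servingLocation Θ r‖ = r + d := by
  rw [newLocation_sub_servingLocation, norm_mul, Complex.norm_exp_ofReal_mul_I, mul_one,
    Complex.norm_real, Real.norm_of_nonneg (by linarith)]

/-- The probability that the SINR is at least `τ`, for a serving link of length `R` with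
exponent `a`. -/
lemma IsModel.measure_le_servingSINR (hp : p.Admissible) (hN : N.IsModel p P) (k : Fin 2)
    (u : ℂ) {τ R : ℝ} (hτ : 0 < τ) (hR : 0 < R) (a : ℝ) :
    P {ω | ENNReal.ofReal τ ≤ ENNReal.ofReal (p.PT * p.Mt * p.Mr * N.h k none ω * R ^ (-a)) /
      (N.interference p k u ω + ENNReal.ofReal (p.σn ^ 2))} =
      ENNReal.ofReal (1 - p.outageFormula τ R a) := by
  have hPT := hp.PT_pos
  have hMt := hp.Mt_pos
  have hMr := hp.Mr_pos
  have hGh := hN.measurable_gain_fading k none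
  have hh := hN.measurable_fading k none
  set κ := p.PT * p.Mt * p.Mr * R ^ (-a) with hκ
  have hκ0 : 0 < κ := by positivity
  have hop := hN.measurable_otherPower k u
  have hset : MeasurableSet {q : (ℕ → ℝ) × ℝ × ℝ | ENNReal.ofReal τ ≤
      ENNReal.ofReal (p.PT * p.Mt * p.Mr * q.2.2 * R ^ (-a)) /
        (∑' i, ENNReal.ofReal (q.1 i) + ENNReal.ofReal (p.σn ^ 2))} := by
    have : Measurable fun q : (ℕ → ℝ) × ℝ × ℝ => ∑' i, ENNReal.ofReal (q.1 i) :=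
      Measurable.tsum fun i => by fun_prop
    exact measurableSet_le measurable_const (by fun_prop)
  have hc : 0 < τ / κ := by positivity
  have hpos : ∀ᵐ ω' ∂P, 0 < N.h k none ω' := by
    have := ae_pos_expMeasure_one
    rw [← hN.map_fading hp k none] at this
    exact ae_of_ae_map hh.aemeasurable this
  calc _ = ∫⁻ ω, P {ω' | ENNReal.ofReal τ ≤
        ENNReal.ofReal (p.PT * p.Mt * p.Mr * N.h k none ω' * R ^ (-a)) /
          (N.interference p k u ω + ENNReal.ofReal (p.σn ^ 2))} ∂P :=
        measure_prodMk_mem_of_indepFun (measurable_pi_lambda _ hop) hGh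
          (hN.indepFun_otherPower_gain_fading k u) hset
    _ = ∫⁻ ω, expNeg (ENNReal.ofReal (τ / κ) * N.interference p k u ω) *
          expNeg (ENNReal.ofReal (τ / κ) * ENNReal.ofReal (p.σn ^ 2)) ∂P := by
        refine lintegral_congr fun ω => ?_
        rw [← expNeg_add, ← mul_add]
        set b := N.interference p k u ω + ENNReal.ofReal (p.σn ^ 2)
        rw [← expMeasure_one_setOf_le, ← hN.map_fading hp k none,
          Measure.map_apply hh (measurableSet_le measurable_const ENNReal.measurable_ofReal)]
        refine measure_congr ?_
        filter_upwards [hpos] with ω' hω'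
        have e1 : p.PT * p.Mt * p.Mr * N.h k none ω' * R ^ (-a) = κ * N.h k none ω' := by
          rw [hκ]; ring
        -- a positive numerator makes the SINR `⊤`, and not `0`, when noise and interference vanish
        have hne : ENNReal.ofReal (κ * N.h k none ω') ≠ 0 := by
          simpa using mul_pos hκ0 hω'
        have hκ1 : ENNReal.ofReal κ ≠ 0 := by simpa using hκ0
        refine propext (?_ : ENNReal.ofReal τ ≤
          ENNReal.ofReal (p.PT * p.Mt * p.Mr * N.h k none ω' * R ^ (-a)) / b ↔
            ENNReal.ofReal (τ / κ) * b ≤ ENNReal.ofReal (N.h k none ω'))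
        rw [e1, ENNReal.le_div_iff_mul_le (Or.inr hne) (Or.inr ENNReal.ofReal_ne_top),
          ← ENNReal.mul_le_mul_iff_right hκ1 ENNReal.ofReal_ne_top
            (b := ENNReal.ofReal (τ / κ) * b), ← mul_assoc, ← ENNReal.ofReal_mul hκ0.le,
            mul_div_cancel₀ _ hκ0.ne', ← ENNReal.ofReal_mul hκ0.le]
    _ = ENNReal.ofReal (1 - p.outageFormula τ R a) := by
        have hI : Measurable (N.interference p k u) :=
          Measurable.tsum fun i => (hop i).ennreal_ofReal
        rw [lintegral_mul_const _ (by fun_prop), hN.lintegral_expNeg_interference hp k u hc,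
          ← ENNReal.ofReal_mul hc.le, expNeg_ofReal (by positivity),
          ← ENNReal.ofReal_mul (Real.exp_pos _).le, Params.outageFormula, sub_sub_cancel,
          mul_comm]
        have e2 : τ / κ = τ / (p.PT * p.Mt * p.Mr) * R ^ a := by
          rw [hκ, Real.rpow_neg hR.le]
          field_simp
        have e3 : ∀ l, τ / κ * p.PT * p.g l = τ * R ^ a * p.g l / (p.Mt * p.Mr) := by
          intro l
          rw [e2]
          field_simp
        simp_rw [e3]
        rw [e2]
        rw [mul_right_comm]

/-- The conditional outage probability. -/
theorem IsModel.condOutage_ae_eq (hp : p.Admissible) (hN : N.IsModel p P) {τh τhys : ℝ}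
    (hτ : τhys < τh) {d : ℝ} (hd : 0 ≤ d) (Θ : ℝ) {r : ℝ} (hr : 0 < r) :
    N.condOutage p P τh τhys Θ Θ d r =ᵐ[P]
      fun ω => p.outageFormula (τh - τhys) (r + d) (N.servingExponent Θ r ω) := by
  set j := sectionIndex M (0 - servingLocation Θ r)
  set u := newLocation Θ d with hu
  have hGh := hN.measurable_gain_fading 1 none
  have hop := hN.measurable_otherPower 1 u
  have hW : Measurable fun ω => ((fun i => N.otherPower p 1 u i ω),
      (N.G 1 none ω, N.h 1 none ω)) :=
    (measurable_pi_lambda _ hop).prodMk hGh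
  set E : Set (ℝ × (ℕ → ℝ) × ℝ × ℝ) := {q |
    ENNReal.ofReal (p.PT * p.Mt * p.Mr * q.2.2.2 * (r + d) ^ (-q.1)) /
      (∑' i, ENNReal.ofReal (q.2.1 i) + ENNReal.ofReal (p.σn ^ 2)) <
        ENNReal.ofReal (τh - τhys)} with hE
  have hEm : MeasurableSet E := by
    have : Measurable fun q : ℝ × (ℕ → ℝ) × ℝ × ℝ => ∑' i, ENNReal.ofReal (q.2.1 i) :=
      Measurable.tsum fun i => by fun_prop
    exact measurableSet_lt (by fun_prop) measurable_const
  have hevent : N.eventA2 p τh τhys Θ Θ d r = {ω | (N.servingExponent Θ r ω,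
      ((fun i => N.otherPower p 1 u i ω), (N.G 1 none ω, N.h 1 none ω))) ∈ E} := by
    ext ω
    have : pathLoss (N.α none ω) (servingLocation Θ r) u =
        (r + d) ^ (-N.servingExponent Θ r ω) := by
      rw [pathLoss, norm_newLocation_sub hr hd, linkExponent, sectionIndex_newLocation_sub hr hd]
      rfl
    simp only [eventA2, servingSINR, mem_ofPred_eq, hE, ← hu, this]
    rfl
  have h := condExp_indicator_ae_eq_of_indepFun (X := N.servingExponent Θ r)
    (hN.measurable_servingExponent Θ r) hW (hN.indepFun_exponent hp 1 u j) hEm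
  rw [condOutage, hevent]
  refine h.trans (ae_of_all _ fun ω => ?_)
  have hc := hN.measure_le_servingSINR hp 1 u (τ := τh - τhys) (sub_pos.2 hτ)
    (add_pos_of_pos_of_nonneg hr hd)
    (N.servingExponent Θ r ω)
  have hle : p.outageFormula (τh - τhys) (r + d) (N.servingExponent Θ r ω) ≤ 1 := by
    rw [Params.outageFormula, sub_le_self_iff]
    positivity
  have hmE : MeasurableSet {ω' | (N.servingExponent Θ r ω,
      ((fun i => N.otherPower p 1 u i ω'), (N.G 1 none ω', N.h 1 none ω'))) ∈ E} :=
    (measurable_const.prodMk hW) hEm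
  have hcompl : {ω' | (N.servingExponent Θ r ω,
      ((fun i => N.otherPower p 1 u i ω'), (N.G 1 none ω', N.h 1 none ω'))) ∈ E}ᶜ =
      {ω' | ENNReal.ofReal (τh - τhys) ≤ ENNReal.ofReal (p.PT * p.Mt * p.Mr * N.h 1 none ω' *
        (r + d) ^ (-N.servingExponent Θ r ω)) /
          (N.interference p 1 u ω' + ENNReal.ofReal (p.σn ^ 2))} := by
    ext ω'
    exact not_lt (α := ℝ≥0∞)
  have hreal := probReal_compl_eq_one_sub (μ := P) hmE
  rw [measureReal_def, measureReal_def, hcompl, hc, ENNReal.toReal_ofReal (by linarith)] at hreal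
  simp only
  linarith

end Network

/-! ### Measurability of the closed forms -/

lemma measurable_Gamma : Measurable Real.Gamma := by
  refine measurable_of_tendsto_metrizable (f := fun n s => Real.GammaSeq s n) (fun n => ?_)
    (tendsto_pi_nhds.2 fun s => Real.GammaSeq_tendsto_Gamma s)
  unfold Real.GammaSeq
  fun_prop

namespace Params

lemma Admissible.measurable_intervalIntegral (hp : p.Admissible) {A : Type*} [MeasurableSpace A]
    {f : A × ℝ → ℝ} (hf : Measurable f) :
    Measurable fun c => ∫ α in p.αmin..p.αmax, f (c, α) := by
  simp_rw [intervalIntegral.integral_of_le hp.αmin_lt_αmax.le]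
  exact (StronglyMeasurable.integral_prod_right' hf.stronglyMeasurable).measurable

lemma Admissible.measurable_assocIntegrand (hp : p.Admissible) (m : Fin 4) :
    Measurable fun q : (ℝ × ℝ) × ℝ =>
      Real.exp (-q.2 - p.lam * Real.pi / (√3 * p.σ) * ∑ n : Fin 4, p.prob n *
        ∫ α in p.αmin..p.αmax,
          (p.g m / p.g n * q.2 * q.1.1 ^ (-q.1.2)) ^ (-2 / α) * Real.Gamma (2 / α) / α) := by
  have hG := measurable_Gamma
  have h1 : Measurable fun c : ℝ => ∫ α in p.αmin..p.αmax,
      c ^ (-2 / α) * Real.Gamma (2 / α) / α :=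
    hp.measurable_intervalIntegral (f := fun q => q.1 ^ (-2 / q.2) * Real.Gamma (2 / q.2) / q.2)
      (by fun_prop)
  have h2 : ∀ n, Measurable fun q : (ℝ × ℝ) × ℝ => ∫ α in p.αmin..p.αmax,
      (p.g m / p.g n * q.2 * q.1.1 ^ (-q.1.2)) ^ (-2 / α) * Real.Gamma (2 / α) / α := fun n =>
    h1.comp (g := fun c : ℝ => ∫ α in p.αmin..p.αmax, c ^ (-2 / α) * Real.Gamma (2 / α) / α)
      (by fun_prop : Measurable fun q : (ℝ × ℝ) × ℝ => p.g m / p.g n * q.2 * q.1.1 ^ (-q.1.2))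
  fun_prop

lemma Admissible.measurable_assocFormula (hp : p.Admissible) :
    Measurable fun q : ℝ × ℝ => p.assocFormula q.1 q.2 := by
  unfold assocFormula
  refine Finset.measurable_fun_sum _ fun m _ => Measurable.const_mul ?_ _
  exact (StronglyMeasurable.integral_prod_right'
    (hp.measurable_assocIntegrand m).stronglyMeasurable).measurable

lemma Admissible.measurable_outageFormula (hp : p.Admissible) (τ : ℝ) :
    Measurable fun q : ℝ × ℝ => p.outageFormula τ q.1 q.2 := by
  have h1 : ∀ l, Measurable fun q : ℝ × ℝ => ∫ α in p.αmin..p.αmax,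
      (τ * q.1 ^ q.2 * p.g l / (p.Mt * p.Mr)) ^ (2 / α) * (Real.sin (2 * Real.pi / α))⁻¹ / α :=
    fun l => hp.measurable_intervalIntegral (f := fun q : (ℝ × ℝ) × ℝ =>
      (τ * q.1.1 ^ q.1.2 * p.g l / (p.Mt * p.Mr)) ^ (2 / q.2) *
        (Real.sin (2 * Real.pi / q.2))⁻¹ / q.2) (by fun_prop)
  unfold outageFormula
  fun_prop

lemma Admissible.measurable_assocFormula_comp (hp : p.Admissible) {A : Type*} [MeasurableSpace A]
    {f g : A → ℝ} (hf : Measurable f) (hg : Measurable g) :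
    Measurable fun x => p.assocFormula (f x) (g x) := by
  have h := hp.measurable_assocFormula.comp (hf.prodMk hg)
  exact h

lemma Admissible.measurable_outageFormula_comp (hp : p.Admissible) (τ : ℝ) {A : Type*}
    [MeasurableSpace A]
    {f g : A → ℝ} (hf : Measurable f) (hg : Measurable g) :
    Measurable fun x => p.outageFormula τ (f x) (g x) := by
  have h := (hp.measurable_outageFormula τ).comp (hf.prodMk hg)
  exact h

lemma Admissible.assocExponent_nonneg (hp : p.Admissible) (m : Fin 4) {h r : ℝ} (hh : 0 ≤ h)
    (hr : 0 ≤ r) (a : ℝ) :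
    0 ≤ p.lam * Real.pi / (√3 * p.σ) * ∑ n : Fin 4, p.prob n *
      ∫ α in p.αmin..p.αmax,
        (p.g m / p.g n * h * r ^ (-a)) ^ (-2 / α) * Real.Gamma (2 / α) / α := by
  have hσ := hp.σ_pos
  have hlam := hp.lam_pos
  refine mul_nonneg (by positivity) (Finset.sum_nonneg fun n _ => mul_nonneg (hp.prob_nonneg n) ?_)
  refine intervalIntegral.integral_nonneg hp.αmin_lt_αmax.le fun α hα => ?_
  have hgm := hp.g_pos m
  have hgn := hp.g_pos n
  have h2 : 0 < α := by have := hp.two_lt_αmin; linarith [hα.1]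
  have := Real.Gamma_pos_of_pos (hp.two_div_mem_Ioo hα).1
  positivity

lemma Admissible.integrableOn_assocIntegrand (hp : p.Admissible) (m : Fin 4) {r : ℝ}
    (hr : 0 ≤ r) (a : ℝ) :
    IntegrableOn (fun h => Real.exp (-h - p.lam * Real.pi / (√3 * p.σ) * ∑ n : Fin 4, p.prob n *
        ∫ α in p.αmin..p.αmax,
          (p.g m / p.g n * h * r ^ (-a)) ^ (-2 / α) * Real.Gamma (2 / α) / α)) (Ioi 0) := by
  refine Integrable.mono' (integrableOn_exp_neg_Ioi 0) ?_ ?_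
  · exact ((hp.measurable_assocIntegrand m).comp (g := fun q : (ℝ × ℝ) × ℝ => _)
      (measurable_prodMk_left (x := (r, a)))).aestronglyMeasurable
  · filter_upwards [ae_restrict_mem measurableSet_Ioi] with h hh
    rw [Real.norm_of_nonneg (Real.exp_pos _).le, Real.exp_le_exp]
    have := hp.assocExponent_nonneg m (le_of_lt hh) hr a
    linarith

lemma Admissible.assocFormula_nonneg (hp : p.Admissible) (r a : ℝ) : 0 ≤ p.assocFormula r a :=
  Finset.sum_nonneg fun m _ => mul_nonneg (hp.prob_nonneg m)
    (setIntegral_nonneg measurableSet_Ioi fun _ _ => (Real.exp_pos _).le)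

end Params

/-! ### The conditional association probability -/

namespace Network

variable {M : ℕ} {Ω : Type*} [MeasurableSpace Ω] {N : Network M Ω}
  {P : Measure Ω} [NeZero M] [IsProbabilityMeasure P]

lemma IsModel.measure_otherPower_le_servingPower (hp : p.Admissible) (hN : N.IsModel p P)
    (k : Fin 2) (u : ℂ) {r : ℝ} (hr : 0 < r) (a : ℝ) :
    P {ω | ∀ i, N.otherPower p k u i ω ≤ p.PT * N.G k none ω * N.h k none ω * r ^ (-a)} =
      ENNReal.ofReal (p.assocFormula r a) := by
  have hPT := hp.PT_pos
  have hGh := hN.measurable_gain_fading k none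
  have hop := hN.measurable_otherPower k u
  have hmeas : Measurable fun q : ℝ × ℝ =>
      P {ω | ∀ i, N.otherPower p k u i ω ≤ p.PT * q.1 * q.2 * r ^ (-a)} :=
    measurable_measure_prodMk_left (ν := P) (s := {q : (ℝ × ℝ) × Ω |
      ∀ i, N.otherPower p k u i q.2 ≤ p.PT * q.1.1 * q.1.2 * r ^ (-a)})
      (measurableSet_setOf_forall_le (f := fun (q : (ℝ × ℝ) × Ω) i => N.otherPower p k u i q.2)
        (measurable_pi_lambda _ fun i => (hop i).comp measurable_snd) (by fun_prop))
  have := hp.isProbabilityMeasure_gainLaw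
  calc _ = ∫⁻ ω, P {ω' | ∀ i, N.otherPower p k u i ω' ≤
        p.PT * N.G k none ω * N.h k none ω * r ^ (-a)} ∂P :=
        measure_prodMk_mem_of_indepFun (S := {q : (ℝ × ℝ) × (ℕ → ℝ) |
          ∀ i, q.2 i ≤ p.PT * q.1.1 * q.1.2 * r ^ (-a)}) hGh (measurable_pi_lambda _ hop)
          (hN.indepFun_otherPower_gain_fading k u).symm
          (measurableSet_setOf_forall_le measurable_snd (by fun_prop))
    _ = ∫⁻ q, P {ω | ∀ i, N.otherPower p k u i ω ≤ p.PT * q.1 * q.2 * r ^ (-a)}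
          ∂(p.gainLaw.prod (expMeasure 1)) := by
        rw [← hN.map_gain_fading hp k none, lintegral_map hmeas hGh]
    _ = ∑ m, ENNReal.ofReal (p.prob m) * ∫⁻ h in Ioi 0, ENNReal.ofReal (Real.exp (-h)) *
          P {ω | ∀ i, N.otherPower p k u i ω ≤ p.PT * p.g m * h * r ^ (-a)} := by
        rw [lintegral_prod _ hmeas.aemeasurable, Params.lintegral_gainLaw]
        refine Finset.sum_congr rfl fun m _ => ?_
        congr 1
        exact lintegral_expMeasure_one (hmeas.comp (measurable_prodMk_left (x := p.g m)))
    _ = ENNReal.ofReal (p.assocFormula r a) := by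
        rw [Params.assocFormula, ENNReal.ofReal_sum_of_nonneg fun m _ =>
          mul_nonneg (hp.prob_nonneg m)
            (setIntegral_nonneg measurableSet_Ioi fun _ _ => (Real.exp_pos _).le)]
        refine Finset.sum_congr rfl fun m _ => ?_
        rw [ENNReal.ofReal_mul (hp.prob_nonneg m), ofReal_integral_eq_lintegral_ofReal
          (hp.integrableOn_assocIntegrand m hr.le a) (ae_of_all _ fun _ => (Real.exp_pos _).le)]
        congr 1
        refine setLIntegral_congr_fun measurableSet_Ioi fun h hh => ?_
        have hh' : 0 < h := hh
        have hgm := hp.g_pos m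
        have e1 : ∀ n, p.PT * p.g m * h * r ^ (-a) / (p.PT * p.g n) =
            p.g m / p.g n * h * r ^ (-a) := fun n => by
          have hgn := hp.g_pos n
          field_simp
        rw [hN.measure_forall_otherPower_le hp k u (by positivity),
          ← ENNReal.ofReal_mul (Real.exp_pos _).le, ← Real.exp_add, ← sub_eq_add_neg]
        simp_rw [e1]

/-- The conditional association probability. -/
theorem IsModel.condAssoc_ae_eq (hp : p.Admissible) (hN : N.IsModel p P) (Θ : ℝ) {r : ℝ}
    (hr : 0 < r) :
    N.condAssoc p P Θ r =ᵐ[P] fun ω => p.assocFormula r (N.servingExponent Θ r ω) := by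
  have hop := hN.measurable_otherPower 0 0
  have hW : Measurable fun ω => ((fun i => N.otherPower p 0 0 i ω),
      (N.G 0 none ω, N.h 0 none ω)) :=
    (measurable_pi_lambda _ hop).prodMk (hN.measurable_gain_fading 0 none)
  set E : Set (ℝ × (ℕ → ℝ) × ℝ × ℝ) := {q |
    ∀ i, q.2.1 i ≤ p.PT * q.2.2.1 * q.2.2.2 * r ^ (-q.1)} with hE
  have hEm : MeasurableSet E := measurableSet_setOf_forall_le measurable_snd.fst (by fun_prop)
  have hnorm : ‖0 - servingLocation Θ r‖ = r := by
    simpa [newLocation] using norm_newLocation_sub hr le_rfl Θ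
  have hevent : N.eventAssoc p Θ r = {ω | (N.servingExponent Θ r ω,
      ((fun i => N.otherPower p 0 0 i ω), (N.G 0 none ω, N.h 0 none ω))) ∈ E} := by
    ext ω
    simp only [eventAssoc, mem_ofPred_eq, hE, pathLoss, hnorm]
    rfl
  have h := condExp_indicator_ae_eq_of_indepFun (X := N.servingExponent Θ r)
    (hN.measurable_servingExponent Θ r) hW
    (hN.indepFun_exponent hp 0 0 (sectionIndex M (0 - servingLocation Θ r))) hEm
  rw [condAssoc, hevent]
  refine h.trans (ae_of_all _ fun ω => ?_)
  have hc := hN.measure_otherPower_le_servingPower hp 0 0 hr (N.servingExponent Θ r ω)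
  exact (congrArg ENNReal.toReal hc).trans (ENNReal.toReal_ofReal (hp.assocFormula_nonneg _ _))

end Network

/-! ### Decay of the association probability -/

/-- The function `exp (-k y ^ (-β))` vanishes faster than `y` as `y` decreases to `0`. -/
lemma exists_exp_neg_mul_rpow_le {k β : ℝ} (hk : 0 < k) (hβ : 0 < β) :
    ∃ C, 1 ≤ C ∧ ∀ y, 0 < y → y ≤ 1 → Real.exp (-(k * y ^ (-β))) ≤ C * y := by
  obtain ⟨n, hn⟩ := exists_nat_ge (1 / β)
  refine ⟨max 1 (n.factorial / k ^ n), le_max_left _ _, fun y hy hy1 => ?_⟩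
  have ht : 0 < k * y ^ (-β) := by positivity
  have h1 : Real.exp (-(k * y ^ (-β))) ≤ n.factorial / (k * y ^ (-β)) ^ n := by
    rw [Real.exp_neg, inv_le_comm₀ (Real.exp_pos _) (by positivity), inv_div]
    exact Real.pow_div_factorial_le_exp _ ht.le n
  have h2 : (n.factorial : ℝ) / (k * y ^ (-β)) ^ n = n.factorial / k ^ n * y ^ (β * n) := by
    rw [mul_pow, ← Real.rpow_natCast (y ^ (-β)), ← Real.rpow_mul hy.le, neg_mul,
      Real.rpow_neg hy.le]
    field_simp
  have h3 : y ^ (β * n) ≤ y := by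
    have : 1 ≤ β * n := by rwa [div_le_iff₀' hβ] at hn
    simpa using Real.rpow_le_rpow_of_exponent_ge hy hy1 this
  calc Real.exp (-(k * y ^ (-β))) ≤ n.factorial / k ^ n * y ^ (β * n) := h1.trans_eq h2
    _ ≤ max 1 (n.factorial / k ^ n) * y := by
        gcongr
        exact le_max_right _ _

/-- The association probability is at most a multiple of the path loss of the serving link: with
`y = B h r ^ (-a)`, where `B` dominates all ratios of gains, the exponent in the association formula
is at least a multiple of `y ^ (-2 / αmax)` when `y ≤ 1`, so that the integrand is at most a
constant times `exp (-h) * y`. For `y > 1` this is trivial. -/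
lemma Params.Admissible.exists_assocFormula_le (hp : p.Admissible) :
    ∃ C, ∀ r, 0 < r → ∀ a, p.assocFormula r a ≤ C * r ^ (-a) := by
  have hσ := hp.σ_pos
  have hlam := hp.lam_pos
  have hg := hp.g_pos
  have hprob := hp.prob_nonneg
  have hmax : 0 < p.αmax := by linarith [hp.two_lt_αmin, hp.αmin_lt_αmax]
  have hpos : ∀ α ∈ Icc p.αmin p.αmax, 0 < α := fun α hα => by
    linarith [hp.two_lt_αmin, hα.1]
  have hΓ : ∀ α ∈ Icc p.αmin p.αmax, 0 < Real.Gamma (2 / α) / α := fun α hα =>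
    div_pos (Real.Gamma_pos_of_pos (hp.two_div_mem_Ioo hα).1) (hpos α hα)
  have hΓc : ContinuousOn (fun α => Real.Gamma (2 / α) / α) (Icc p.αmin p.αmax) :=
    (continuousOn_Gamma_comp hp.continuousOn_two_div fun α hα => (hp.two_div_mem_Ioo hα).1).div
      continuousOn_id fun α hα => (hpos α hα).ne'
  have hle := hp.αmin_lt_αmax.le
  have hu : uIcc p.αmin p.αmax = Icc p.αmin p.αmax := uIcc_of_le hle
  set D := ∫ α in p.αmin..p.αmax, Real.Gamma (2 / α) / α with hD
  have hD0 : 0 < D := intervalIntegral.intervalIntegral_pos_of_pos_on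
    (hΓc.intervalIntegrable_of_Icc hle) (fun α hα => hΓ α (Ioo_subset_Icc_self hα))
    hp.αmin_lt_αmax
  set B := ∑ m, ∑ n, p.g m / p.g n
  have hB1 : ∀ m n, p.g m / p.g n ≤ B := fun m n =>
    (Finset.single_le_sum (f := fun n => p.g m / p.g n) (fun n _ => (div_pos (hg m) (hg n)).le)
      (Finset.mem_univ n)).trans (Finset.single_le_sum (f := fun m => ∑ n, p.g m / p.g n)
        (fun m _ => Finset.sum_nonneg fun n _ => (div_pos (hg m) (hg n)).le) (Finset.mem_univ m))
  have hB0 : 0 < B := (div_pos (hg 0) (hg 0)).trans_le (hB1 0 0)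
  set c := p.lam * Real.pi / (√3 * p.σ) with hc
  have hc0 : 0 < c := by positivity
  obtain ⟨C, hC1, hC⟩ := exists_exp_neg_mul_rpow_le (mul_pos hc0 hD0) (div_pos two_pos hmax)
  refine ⟨C * B, fun r hr a => ?_⟩
  have key : ∀ m, ∀ h, 0 < h → Real.exp (-h - c * ∑ n : Fin 4, p.prob n *
      ∫ α in p.αmin..p.αmax, (p.g m / p.g n * h * r ^ (-a)) ^ (-2 / α) *
        Real.Gamma (2 / α) / α) ≤ C * B * r ^ (-a) * (Real.exp (-h) * h ^ ((2 : ℝ) - 1)) := by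
    intro m h hh
    have hr' : 0 < r ^ (-a) := by positivity
    set y := B * h * r ^ (-a) with hy
    have hy0 : 0 < y := by positivity
    have hK := hp.assocExponent_nonneg m hh.le hr.le a
    rw [← hc] at hK
    suffices hs : Real.exp (-(c * ∑ n : Fin 4, p.prob n * ∫ α in p.αmin..p.αmax,
        (p.g m / p.g n * h * r ^ (-a)) ^ (-2 / α) * Real.Gamma (2 / α) / α)) ≤ C * y by
      rw [sub_eq_add_neg, Real.exp_add]
      calc _ ≤ Real.exp (-h) * (C * y) := by gcongr
        _ = _ := by
          rw [hy]; norm_num; ring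
    rcases le_or_gt y 1 with hy1 | hy1
    · refine le_trans (Real.exp_le_exp.2 (neg_le_neg ?_)) (hC y hy0 hy1)
      rw [mul_assoc]
      refine mul_le_mul_of_nonneg_left ?_ hc0.le
      have hn : ∀ n, D * y ^ (-(2 / p.αmax)) ≤ ∫ α in p.αmin..p.αmax,
          (p.g m / p.g n * h * r ^ (-a)) ^ (-2 / α) * Real.Gamma (2 / α) / α := by
        intro n
        have hq : 0 < p.g m / p.g n * h * r ^ (-a) :=
          mul_pos (mul_pos (div_pos (hg m) (hg n)) hh) hr'
        rw [hD, ← intervalIntegral.integral_mul_const]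
        refine intervalIntegral.integral_mono_on hle
          ((hΓc.intervalIntegrable_of_Icc hle).mul_const _) ?_ fun α hα => ?_
        · have : ContinuousOn (fun α : ℝ => -2 / α) (Icc p.αmin p.αmax) :=
            continuousOn_const.div continuousOn_id fun α hα => (hpos α hα).ne'
          have h2 := (continuousOn_const_rpow_comp hq this).mul hΓc
          simp_rw [mul_div_assoc]
          exact h2.intervalIntegrable_of_Icc hle
        · rw [mul_comm, mul_div_assoc]
          refine mul_le_mul_of_nonneg_right ?_ (hΓ α hα).le
          have hα0 := hpos α hα
          calc y ^ (-(2 / p.αmax)) ≤ y ^ (-2 / α) := by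
                refine Real.rpow_le_rpow_of_exponent_ge hy0 hy1 ?_
                rw [neg_div, neg_le_neg_iff]
                exact div_le_div_of_nonneg_left two_pos.le hα0 hα.2
            _ ≤ _ := by
                refine Real.rpow_le_rpow_of_nonpos hq ?_ ?_
                · rw [hy]
                  gcongr
                  exact hB1 m n
                · rw [neg_div]
                  have : 0 < 2 / α := by positivity
                  linarith
      calc D * y ^ (-(2 / p.αmax)) = ∑ n, p.prob n * (D * y ^ (-(2 / p.αmax))) := by
            rw [← Finset.sum_mul, p.sum_prob, one_mul]
        _ ≤ _ := Finset.sum_le_sum fun n _ => mul_le_mul_of_nonneg_left (hn n) (hprob n)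
    · calc _ ≤ Real.exp 0 := Real.exp_le_exp.2 (by linarith)
        _ ≤ C * y := by rw [Real.exp_zero]; nlinarith
  have hint := (Real.GammaIntegral_convergent (s := 2) two_pos).const_mul (C * B * r ^ (-a))
  have hGamma : ∫ h in Ioi (0 : ℝ), C * B * r ^ (-a) * (Real.exp (-h) * h ^ ((2 : ℝ) - 1)) =
      C * B * r ^ (-a) := by
    rw [integral_const_mul, ← Real.Gamma_eq_integral two_pos, Real.Gamma_two, mul_one]
  calc p.assocFormula r a ≤ ∑ m, p.prob m * (C * B * r ^ (-a)) := by
        refine Finset.sum_le_sum fun m _ => mul_le_mul_of_nonneg_left ?_ (hprob m)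
        rw [← hGamma]
        exact setIntegral_mono_on (hp.integrableOn_assocIntegrand m hr.le a) hint
          measurableSet_Ioi fun h hh => key m h hh
    _ = C * B * r ^ (-a) := by rw [← Finset.sum_mul, p.sum_prob, one_mul]

/-! ### The handoff probability -/

namespace Network

variable {M : ℕ} {Ω : Type*} [MeasurableSpace Ω] {N : Network M Ω}
  {P : Measure Ω} [NeZero M] [IsProbabilityMeasure P]

lemma IsModel.outageFormula_mem_Icc (hp : p.Admissible) (hN : N.IsModel p P) {τ R : ℝ}
    (hτ : 0 < τ) (hR : 0 < R) (a : ℝ) : p.outageFormula τ R a ∈ Icc (0 : ℝ) 1 := by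
  constructor
  · have h := hN.measure_le_servingSINR hp 0 0 hτ hR a
    have h1 : ENNReal.ofReal (1 - p.outageFormula τ R a) ≤ 1 := h ▸ prob_le_one
    rw [ENNReal.ofReal_le_one] at h1
    linarith
  · rw [Params.outageFormula, sub_le_self_iff]
    positivity

lemma IsModel.assocFormula_le_one (hp : p.Admissible) (hN : N.IsModel p P) {r : ℝ}
    (hr : 0 < r) (a : ℝ) : p.assocFormula r a ≤ 1 := by
  rw [← ENNReal.ofReal_le_one, ← hN.measure_otherPower_le_servingPower hp 0 0 hr a]
  exact prob_le_one

/-- The handoff density in closed form. -/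
theorem IsModel.handoffDensity_eq (hp : p.Admissible) (hN : N.IsModel p P) {τh τhys : ℝ}
    (hτ : τhys < τh) {d : ℝ} (hd : 0 ≤ d) (Θ : ℝ) {r : ℝ} (hr : 0 < r) :
    N.handoffDensity p P τh τhys Θ Θ d r =
      ∫ a, p.outageFormula (τh - τhys) (r + d) a * p.assocFormula r a ∂p.exponentLaw := by
  have hm : Measurable fun a => p.outageFormula (τh - τhys) (r + d) a * p.assocFormula r a :=
    (hp.measurable_outageFormula_comp _ measurable_const measurable_id).mul
      (hp.measurable_assocFormula_comp measurable_const measurable_id)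
  have hmap : P.map (N.servingExponent Θ r) = p.exponentLaw := hN.map_exponent hp none _
  rw [handoffDensity, ← hmap, integral_map (hN.measurable_servingExponent Θ r).aemeasurable
    hm.aestronglyMeasurable]
  refine integral_congr_ae ?_
  filter_upwards [hN.condOutage_ae_eq hp hτ hd Θ hr, hN.condAssoc_ae_eq hp Θ hr] with ω h1 h2
  rw [h1, h2]

theorem IsModel.integrableOn_handoffDensity (hp : p.Admissible) (hN : N.IsModel p P) {τh τhys : ℝ}
    (hτ : τhys < τh) {d : ℝ} (hd : 0 ≤ d) (Θ : ℝ) :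
    IntegrableOn (N.handoffDensity p P τh τhys Θ Θ d) (Ioi 0) := by
  have := hp.isProbabilityMeasure_exponentLaw
  set H : ℝ → ℝ := fun r =>
    ∫ a, p.outageFormula (τh - τhys) (r + d) a * p.assocFormula r a ∂p.exponentLaw
  have hHm : StronglyMeasurable H := by
    refine StronglyMeasurable.integral_prod_right' (f := fun q : ℝ × ℝ =>
      p.outageFormula (τh - τhys) (q.1 + d) q.2 * p.assocFormula q.1 q.2) ?_
    exact ((hp.measurable_outageFormula_comp _ (measurable_fst.add_const d) measurable_snd).mul
      (hp.measurable_assocFormula_comp measurable_fst measurable_snd)).stronglyMeasurable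
  have hbd : ∀ r, 0 < r → ∀ c, (∀ a ∈ Icc p.αmin p.αmax, p.assocFormula r a ≤ c) →
      ‖H r‖ ≤ c := by
    intro r hr c hc
    have h := norm_integral_le_of_norm_le_const (μ := p.exponentLaw) (C := c)
      (f := fun a => p.outageFormula (τh - τhys) (r + d) a * p.assocFormula r a) (by
        filter_upwards [p.ae_mem_exponentLaw] with a ha
        have hO := hN.outageFormula_mem_Icc hp (sub_pos.2 hτ)
          (add_pos_of_pos_of_nonneg hr hd) a
        have hA := hp.assocFormula_nonneg r a
        rw [Real.norm_of_nonneg (mul_nonneg hO.1 hA)]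
        exact (mul_le_of_le_one_left hA hO.2).trans (hc a ha))
    simpa using h
  obtain ⟨C, hC⟩ := hp.exists_assocFormula_le
  have hC0 : 0 ≤ C := by
    have := (hp.assocFormula_nonneg 1 0).trans (hC 1 one_pos 0)
    simpa using this
  have hint : IntegrableOn H (Ioi 0) := by
    rw [← Ioc_union_Ioi_eq_Ioi (zero_le_one (α := ℝ))]
    refine IntegrableOn.union ?_ ?_
    · refine Measure.integrableOn_of_bounded (M := 1) (by simp) hHm.aestronglyMeasurable ?_
      filter_upwards [ae_restrict_mem measurableSet_Ioc] with r hr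
      exact hbd r hr.1 1 fun a _ => hN.assocFormula_le_one hp hr.1 a
    · refine Integrable.mono' ((integrableOn_Ioi_rpow_of_lt (a := -p.αmin)
        (by linarith [hp.two_lt_αmin]) one_pos).const_mul C) hHm.aestronglyMeasurable ?_
      filter_upwards [ae_restrict_mem measurableSet_Ioi] with r hr
      have hr1 : 1 < r := hr
      have hr0 : 0 < r := by linarith
      refine hbd r hr0 _ fun a ha => (hC r hr0 a).trans ?_
      gcongr
      · exact hr1.le
      · exact ha.1
  exact hint.congr_fun (fun r hr => (hN.handoffDensity_eq hp hτ hd Θ hr).symm) measurableSet_Ioi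

end Network

end SmallCell

end

theorem theorem5 {Ω : Type*} [MeasurableSpace Ω] (P : MeasureTheory.Measure Ω)
    [MeasureTheory.IsProbabilityMeasure P] (p : SmallCell.Params) (hp : p.Admissible)
    (M : ℕ) [NeZero M] (N : SmallCell.Network M Ω) (hN : N.IsModel p P)
    (τh τhys : ℝ) (hτ : τhys < τh) (v t : ℝ) (hv : 0 ≤ v) (ht : 0 ≤ t)
    (Θ φ : ℝ) (hφ : φ = Θ) :
    (∀ r : ℝ, 0 < r →
      N.condOutage p P τh τhys Θ φ (v * t) r =ᵐ[P]
        fun ω => p.outageFormula (τh - τhys) (r + v * t) (N.servingExponent Θ r ω)) ∧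
    (∀ r : ℝ, 0 < r →
      N.condAssoc p P Θ r =ᵐ[P] fun ω => p.assocFormula r (N.servingExponent Θ r ω)) ∧
    MeasureTheory.IntegrableOn (N.handoffDensity p P τh τhys Θ φ (v * t)) (Set.Ioi 0) ∧
    N.handoffProb p P τh τhys Θ φ (v * t) =
      ∫ r in Set.Ioi (0 : ℝ), ∫ a in (p.μ - √3 * p.σ)..(p.μ + √3 * p.σ),
        1 / (2 * √3 * p.σ) *
          (1 - Real.exp (-((τh - τhys) / (p.PT * p.Mt * p.Mr) * p.σn ^ 2 * (r + v * t) ^ a)) *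
            Real.exp (-(p.lam * Real.pi ^ 2 / (√3 * p.σ) * ∑ l : Fin 4, p.prob l *
              ∫ α in (p.μ - √3 * p.σ)..(p.μ + √3 * p.σ),
                ((τh - τhys) * (r + v * t) ^ a * p.g l / (p.Mt * p.Mr)) ^ (2 / α) *
                  (Real.sin (2 * Real.pi / α))⁻¹ / α))) *
          (∑ m : Fin 4, p.prob m * ∫ h in Set.Ioi (0 : ℝ),
            Real.exp (-h - p.lam * Real.pi / (√3 * p.σ) * ∑ n : Fin 4, p.prob n *
              ∫ α in (p.μ - √3 * p.σ)..(p.μ + √3 * p.σ),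
                (p.g m / p.g n * h * r ^ (-a)) ^ (-2 / α) * Real.Gamma (2 / α) / α)) := by
  subst hφ
  have hd : 0 ≤ v * t := mul_nonneg hv ht
  refine ⟨fun r hr => hN.condOutage_ae_eq hp hτ hd φ hr, fun r hr => hN.condAssoc_ae_eq hp φ hr,
    hN.integrableOn_handoffDensity hp hτ hd φ, ?_⟩
  refine MeasureTheory.setIntegral_congr_fun measurableSet_Ioi fun r hr => ?_
  refine (hN.handoffDensity_eq hp hτ hd φ hr).trans ((hp.integral_exponentLaw _).trans ?_)
  exact intervalIntegral.integral_congr fun a _ => (mul_assoc _ _ _).symm
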